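/- **Conventions.** A graph $K$ (with edges of length 1) is *$\delta$-hyperbolic* if it is connected and its geodesic triangles are $\delta$-thin: vertices $a\in[x,y]$, $b\in[x,z]$ at the same distance $\le (y\cdot z)_x=\frac12(|x-y|+|x-z|-|y-z|)$ from $x$ satisfy $|a-b|\le\delta$. It is *fine* if for all $L$ every edge lies in only finitely many circuits of length less than $L$. A graph $K$ is *associated* to a group $\Gamma$ hyperbolic relative to a family $\mathcal G$ of subgroups if $K$ is hyperbolic and fine, $\Gamma$ acts on $K$ with finite edge stabilizers and finite quotient graph, and the stabilizers of the vertices of infinite valence are exactly the elements of $\mathcal G$ and are finitely generated. Paths are simplicial paths parametrized by arc length. The angle at $v$ between edges $(v,v_1),(v,v_2)$ is the length of a shortest path from $v_1$ to $v_2$ avoiding $v$ ($\infty$ if there is none). For an edge $e$ with end $v$, the cone of radius and angle $r$ centered at $(e,v)$ is the set of vertices $w$ with $|v-w|\le r$ such that some geodesic $[v,w]$ has all angles between its consecutive edges, and its angle with $e$ at $v$, at most $r$. The $r$-conical neighborhood of a geodesic segment is the union of the cones of radius and angle $r$ centered at its edges. A path $q$ is a $\Lambda$-quasi-geodesic if $|s-t|/\Lambda\le|q(s)-q(t)|\le\Lambda|s-t|$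 for all $s,t$; it is an $L$-local quasi-geodesic (an $L$-local geodesic) if its subpaths of length at most $L$ are quasi-geodesics (geodesics). Let $\delta>1$ be an integer, $\lambda=1000\delta$. For an integer $\varepsilon$ let $\mu=(100\varepsilon+\lambda^2)\cdot 40\lambda$. For an integer $l>\mu$, an *$l$-coarse-piecewise-geodesic* from $x$ to $y$ is a $40\lambda(\varepsilon+100\lambda\delta)$-local-$\frac{\lambda}{2}$-quasi-geodesic $f:[a,b]\to K$ from $x$ to $y$ with a subdivision $a=c_1\le d_1\le c_2\le\dots\le d_m=b$ such that each $f|_{[c_i,d_i]}$ is a $\mu$-local geodesic, of length at least $l$ if $1<i<m$; each $f|_{[d_i,c_{i+1}]}$ has length at most $\varepsilon$; and $f$ stays in the $2\varepsilon$-neighborhood of some geodesic segment $[x,y]$. The *$l$-cylinder* $\mathrm{Cyl}_l(x,y)$ is the set of vertices $v$ that lie, for some such $f$ and some $i$, on $f|_{[c_i,d_i]}$, with $|f(c_i)-v|\ge l$ if $f(c_i)\ne x$ and $|f(d_i)-v|\ge l$ if $f(d_i)\ne y$. A *channel* of a geodesic segment $g$ is a geodesic segment not shorter than $g$ that stays in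 the $\varepsilon$-conical neighborhood of $g$. **Theorem.** Let $\delta>1$ be an integer. There is an integer $N=N(\delta)$ such that every integer $\varepsilon\ge N$ has the following properties. 1. In every $\delta$-hyperbolic graph, every vertex of a $\lambda$-quasi-geodesic with distinct ends lies in the $\varepsilon$-conical neighborhood of any geodesic segment with the same ends. 2. Let $K$ be a $\delta$-hyperbolic graph associated to a relatively hyperbolic group $\Gamma$. There is a function $\mathrm{Capa}:\mathbb N\to\mathbb N$ (depending only on $K$ and $\varepsilon$) such that every geodesic segment of length $L$ of $K$ has at most $\mathrm{Capa}(L)$ channels, and such that, with $\varphi(n)=24(n+1)\,\mathrm{Capa}(\mu)(2\varepsilon+1)\varepsilon$, the following holds. Let $F$ be a finite subset of $\Gamma$, $n=(2\,\mathrm{Card}\,F)^3$, and let $p$ be a vertex of $K$. There is an integer $l>\mu$ such that for all $\alpha,\beta,\gamma\in F\cup F^{-1}$ with $\alpha\beta\gamma=1$, in the triangle $(x,y,z)=(p,\alpha p,\gamma^{-1}p)$ one has $$\mathrm{Cyl}_l(x,y)\cap B_{R_{x,y,z}}(x)=\mathrm{Cyl}_l(x,z)\cap B_{R_{x,y,z}}(x),\qquad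 R_{x,y,z}=(y\cdot z)_x-4\,(11\mu+\varphi(n)),$$ and likewise at the vertices $y$ and $z$, permuting $x,y,z$. Here $B_R(x)$ is the closed ball of radius $R$ around $x$ (empty if $R<0$). -/

import Mathlib

universe u v

/-- Geodesic segments of a graph: walks whose length is the distance between their ends. -/
def IsGeodesicSegment {V : Type u} {K : SimpleGraph V} {x y : V} (g : K.Walk x y) : Prop :=
  g.length = K.dist x y

/-- The Gromov product `(y · z)_x`. -/
noncomputable def gromovProduct {V : Type u} (K : SimpleGraph V) (x y z : V) : ℝ :=
  ((K.dist x y : ℝ) + (K.dist x z : ℝ) - (K.dist y z : ℝ)) / 2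

/-- The (closed) ball of radius `R` around `x`; it is empty if `R < 0`. -/
def graphBall {V : Type u} (K : SimpleGraph V) (R : ℝ) (x : V) : Set V :=
  {w | (K.dist x w : ℝ) ≤ R}

/-- `δ`-hyperbolic graphs: connected graphs in which geodesic triangles are `δ`-thin, i.e. two
vertices `a`, `b` on geodesics `[x, y]`, `[x, z]`, at the same distance from `x`, this distance
being at most `(y · z)_x`, are `δ`-close to one another. -/
def IsHyperbolicGraph {V : Type u} (δ : ℕ) (K : SimpleGraph V) : Prop :=
  K.Connected ∧
  ∀ x y z a b : V,
    K.dist x a + K.dist a y = K.dist x y →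
    K.dist x b + K.dist b z = K.dist x z →
    K.dist x a = K.dist x b →
    (K.dist x a : ℝ) ≤ gromovProduct K x y z →
    K.dist a b ≤ δ

/-- The circuits (simple simplicial loops, recorded by their edge sets) of length less than `L`
that contain the edge `e`. -/
def circuitsThrough {V : Type u} (K : SimpleGraph V) (L : ℕ) (e : Sym2 V) :
    Set (Set (Sym2 V)) :=
  {E | ∃ (w : V) (c : K.Walk w w), c.IsCycle ∧ c.length < L ∧ e ∈ c.edges ∧
    E = {e' | e' ∈ c.edges}}

/-- Fine graphs. -/
def IsFine {V : Type u} (K : SimpleGraph V) : Prop :=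
  ∀ (L : ℕ) (e : Sym2 V), e ∈ K.edgeSet → (circuitsThrough K L e).Finite

/-- `K`, with the given action of `Γ`, is a graph associated to `Γ` as a group hyperbolic
relative to the family `𝒢` of subgroups. -/
structure IsAssociatedGraph (Γ : Type v) [Group Γ] (𝒢 : Set (Subgroup Γ))
    {V : Type u} [MulAction Γ V] (K : SimpleGraph V) : Prop where
  adj_smul : ∀ (γ : Γ) (a b : V), K.Adj a b → K.Adj (γ • a) (γ • b)
  hyperbolic : ∃ δ : ℕ, IsHyperbolicGraph δ K
  fine : IsFine K
  finite_edge_stabilizer : ∀ e ∈ K.edgeSet, {γ : Γ | Sym2.map (fun a => γ • a) e = e}.Finite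
  finite_vertex_orbits : ∃ S : Set V, S.Finite ∧ ∀ a : V, ∃ s ∈ S, ∃ γ : Γ, γ • s = a
  finite_edge_orbits : ∃ S : Set (Sym2 V), S.Finite ∧
    ∀ e ∈ K.edgeSet, ∃ s ∈ S, ∃ γ : Γ, Sym2.map (fun a => γ • a) s = e
  mem_family_iff : ∀ H : Subgroup Γ,
    H ∈ 𝒢 ↔ ∃ a : V, (K.neighborSet a).Infinite ∧ MulAction.stabilizer Γ a = H
  family_fg : ∀ H ∈ 𝒢, H.FG

/-- The angle at `a` between the edges `(a, b)` and `(a, c)`: the length of a shortest path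
from `b` to `c` that avoids `a`, and `⊤` if there is none. -/
noncomputable def angleAt {V : Type u} (K : SimpleGraph V) (a b c : V) : ℕ∞ :=
  ⨅ (q : K.Walk b c) (_ : a ∉ q.support), (q.length : ℕ∞)

/-- The maximal angle between consecutive edges of a path. -/
noncomputable def maxAngle {V : Type u} {K : SimpleGraph V} {x y : V} (q : K.Walk x y) : ℕ∞ :=
  ⨆ (i : ℕ) (_ : 0 < i ∧ i < q.length),
    angleAt K (q.getVert i) (q.getVert (i - 1)) (q.getVert (i + 1))

/-- The cone of radius `r` and angle `θ` centered at `(e, a)`, where `e` is the edge `(a, b)`.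
The angle condition at `a` is void for the trivial segment, so that `a` is in the cone. -/
def cone {V : Type u} (K : SimpleGraph V) (r θ : ℕ) (a b : V) : Set V :=
  {w | K.dist a w ≤ r ∧ ∃ g : K.Walk a w, IsGeodesicSegment g ∧ maxAngle g ≤ (θ : ℕ∞) ∧
    (0 < g.length → angleAt K a b (g.getVert 1) ≤ (θ : ℕ∞))}

/-- The union of the cones of radius and angle `r` centered at the edges of `g` (at both of
their ends). -/
def conicalNeighborhood {V : Type u} {K : SimpleGraph V} {x y : V} (r : ℕ) (g : K.Walk x y) :
    Set V :=
  {w | ∃ a b : V, s(a, b) ∈ g.edges ∧ w ∈ cone K r r a b}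

/-- The subpath of `q` between the instants `s` and `t` is a `Λ`-quasi-geodesic. -/
def IsQuasiGeodesicOn {V : Type u} {K : SimpleGraph V} {x y : V} (q : K.Walk x y) (Λ : ℝ)
    (s t : ℕ) : Prop :=
  ∀ i j : ℕ, s ≤ i → i ≤ j → j ≤ t →
    ((j : ℝ) - (i : ℝ)) / Λ ≤ (K.dist (q.getVert i) (q.getVert j) : ℝ) ∧
    (K.dist (q.getVert i) (q.getVert j) : ℝ) ≤ Λ * ((j : ℝ) - (i : ℝ))

/-- `q` is a `Λ`-quasi-geodesic. -/
def IsQuasiGeodesic {V : Type u} {K : SimpleGraph V} {x y : V} (q : K.Walk x y) (Λ : ℝ) : Prop :=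
  IsQuasiGeodesicOn q Λ 0 q.length

/-- `q` is an `L`-local-`Λ`-quasi-geodesic. -/
def IsLocalQuasiGeodesic {V : Type u} {K : SimpleGraph V} {x y : V} (q : K.Walk x y)
    (L : ℕ) (Λ : ℝ) : Prop :=
  ∀ s t : ℕ, s ≤ t → t ≤ q.length → t - s ≤ L → IsQuasiGeodesicOn q Λ s t

/-- The subpath of `q` between the instants `c` and `d` is an `M`-local geodesic. -/
def IsLocalGeodesicOn {V : Type u} {K : SimpleGraph V} {x y : V} (q : K.Walk x y)
    (M : ℕ) (c d : ℕ) : Prop :=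
  ∀ s t : ℕ, c ≤ s → s ≤ t → t ≤ d → t - s ≤ M →
    K.dist (q.getVert s) (q.getVert t) = t - s

/-- `N` is a constant for the conical stability of `Λ`-quasi-geodesics in all `δ`-hyperbolic
graphs: every vertex of a `Λ`-quasi-geodesic lies in a cone of radius and angle `N` centered at
an edge of any given geodesic segment with the same (distinct) ends. -/
def IsConicalStabilityConstant (Λ : ℝ) (δ N : ℕ) : Prop :=
  ∀ (V : Type u) (K : SimpleGraph V), IsHyperbolicGraph δ K →
    ∀ (x y : V) (g q : K.Walk x y), x ≠ y → IsGeodesicSegment g → IsQuasiGeodesic q Λ →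
      ∀ w ∈ q.support, w ∈ conicalNeighborhood N g

/-- The constant `λ = 1000 δ`. -/
def lam (δ : ℕ) : ℕ := 1000 * δ

/-- The constant `μ = (100 ε + λ²) · 40 λ`. -/
def mu (δ ε : ℕ) : ℕ := (100 * ε + lam δ ^ 2) * (40 * lam δ)

/-- The walk `f`, with the subdivision `0 = c 0 ≤ d 0 ≤ c 1 ≤ d 1 ≤ ⋯ ≤ d m = length f`, is an
`l`-coarse-piecewise-geodesic. -/
structure IsCoarsePiecewiseGeodesic {V : Type u} {K : SimpleGraph V} (δ ε l : ℕ) {x y : V}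
    (f : K.Walk x y) {m : ℕ} (c d : Fin (m + 1) → ℕ) : Prop where
  start : c 0 = 0
  finish : d (Fin.last m) = f.length
  c_le_d : ∀ i, c i ≤ d i
  d_le_c : ∀ i : Fin m, d i.castSucc ≤ c i.succ
  local_quasi : IsLocalQuasiGeodesic f (40 * lam δ * (ε + 100 * lam δ * δ)) ((lam δ : ℝ) / 2)
  local_geodesic : ∀ i, IsLocalGeodesicOn f (mu δ ε) (c i) (d i)
  long : ∀ i, i ≠ 0 → i ≠ Fin.last m → l ≤ d i - c i
  bridge : ∀ i : Fin m, c i.succ - d i.castSucc ≤ ε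
  near : ∃ g : K.Walk x y, IsGeodesicSegment g ∧
    ∀ w ∈ f.support, ∃ w' ∈ g.support, K.dist w w' ≤ 2 * ε

/-- The `l`-cylinder of `x` and `y`. -/
def cylinder {V : Type u} (K : SimpleGraph V) (δ ε l : ℕ) (x y : V) : Set V :=
  {w | ∃ (f : K.Walk x y) (m : ℕ) (c d : Fin (m + 1) → ℕ),
    IsCoarsePiecewiseGeodesic δ ε l f c d ∧
    ∃ (i : Fin (m + 1)) (t : ℕ), c i ≤ t ∧ t ≤ d i ∧ f.getVert t = w ∧
      (f.getVert (c i) ≠ x → l ≤ K.dist (f.getVert (c i)) w) ∧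
      (f.getVert (d i) ≠ y → l ≤ K.dist (f.getVert (d i)) w)}

/-- The channels of a geodesic segment `g` (recorded by their lists of vertices): geodesic
segments not shorter than `g` that stay in the union of the cones of radius and angle `ε`
centered at the edges of `g`. -/
def channels {V : Type u} {K : SimpleGraph V} (ε : ℕ) {x y : V} (g : K.Walk x y) :
    Set (List V) :=
  {s | ∃ (a b : V) (q : K.Walk a b), IsGeodesicSegment q ∧ g.length ≤ q.length ∧
    (∀ w ∈ q.support, w ∈ conicalNeighborhood ε g) ∧ s = q.support}

/-- `Capa L` bounds the number of channels of every geodesic segment of length `L`. -/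
def IsCapacityBound {V : Type u} (K : SimpleGraph V) (ε : ℕ) (Capa : ℕ → ℕ) : Prop :=
  ∀ (x y : V) (g : K.Walk x y), IsGeodesicSegment g →
    (channels ε g).encard ≤ (Capa g.length : ℕ∞)

/-- The function `φ(n) = 24 (n + 1) Capa(μ) (2 ε + 1) ε`. -/
def phi (δ ε : ℕ) (Capa : ℕ → ℕ) (n : ℕ) : ℕ :=
  24 * (n + 1) * Capa (mu δ ε) * (2 * ε + 1) * ε

/-- The radius `R_{x,y,z} = (y · z)_x - 4 (11 μ + φ(n))`. -/
noncomputable def agreementRadius {V : Type u} (K : SimpleGraph V) (δ ε : ℕ) (Capa : ℕ → ℕ)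
    (n : ℕ) (x y z : V) : ℝ :=
  gromovProduct K x y z - 4 * (11 * (mu δ ε : ℝ) + (phi δ ε Capa n : ℝ))

/-- The `l`-cylinders of `(x, y)` and of `(x, z)` agree in the ball of radius `R_{x,y,z}`
around `x`. -/
def CylindersAgreeAt {V : Type u} (K : SimpleGraph V) (δ ε : ℕ) (Capa : ℕ → ℕ) (n l : ℕ)
    (x y z : V) : Prop :=
  cylinder K δ ε l x y ∩ graphBall K (agreementRadius K δ ε Capa n x y z) x =
    cylinder K δ ε l x z ∩ graphBall K (agreementRadius K δ ε Capa n x y z) x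

/-!
The proof works with paths given by sequences of vertices `f : ℕ → V` and their lengths.

*Conical stability.* By the Morse lemma (`exists_morse_constant`, proved from the exponential
divergence of paths from geodesics), a quasi-geodesic stays close to any geodesic `g` with the same
ends. A vertex `w` of the quasi-geodesic is joined to a nearest vertex of `g` by a short geodesic.
A quasi-geodesic passes at most once through a given vertex `u`; one of its two halves at `w`
therefore avoids `u`, and it leads back to `g` after a bounded length. This provides detours that
bound the angles along the short geodesic, hence `w` lies in a cone of bounded radius and angle
(`exists_conical_constant`).

*Finiteness.* Two edges that make an angle at most `θ` lie on a common circuit of length less than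
`θ + 3`. By fineness, and since there are finitely many orbits of edges, the cones of a given radius
and angle have uniformly bounded cardinality (`exists_cone_bound`). This bounds the number of
channels (`isCapacityBound_of_cone_bound`).

*Redirection.* Let the geodesics from `x` to `y` and from `x` to `z` be close to one another up to
the distance `G` from `x`. If, before this distance, a section of a coarse piecewise geodesic `f`
to `y` has length at least `l + cutLength`, then along its end `t ↦ t + |f t - z|` is nondecreasing
and takes few values; thus it is constant on a long interval, after which `f` may be replaced with a
geodesic to `z`. The new path is again a coarse piecewise geodesic, and the vertices that `f` puts
in the `l`-cylinder of `(x, y)` through previous sections belong to the `l`-cylinder of `(x, z)`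
(`IsTrack.mem_cylinder_of_long_section`).

*Counting bad scales.* Call `l` bad for `(x, y, z)` if some vertex of the ball of radius `R` is in
the `l`-cylinder of `(x, y)` and not in the one of `(x, z)`. By redirection, on a path that
witnesses this, the sections that follow the bad vertex before the distance `G` all have length
between `l` and `l + cutLength`. Consider such a section at a prescribed distance from `x`, in it a
subpath of length `mu`, and the time `e` that the path still spends in this section
(`IsBadScale.exists_isPassage`). If two bad scales `l` and `l' ≥ l + cutLength` give the same
subpath, the two paths can be spliced along it (`IsPassage.exists_splice`), in either order, with
remaining times `e` and `e'`.
* If `e ≤ e'`, then follow the first path, and next the second one. The section of the splicing is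
  long enough for the scale `l`, and the following one has length at least `l' ≥ l + cutLength`:
  the splicing can be redirected, so that the bad vertex of scale `l` is not bad
  (`IsPassage.mem_cylinder_of_le`).
* If `e ≥ e' + cutLength`, then follow the second path, and next the first one. The section of the
  splicing itself has length at least `l' + cutLength`, so that the bad vertex of scale `l'` is not
  bad (`IsPassage.mem_cylinder_of_longer`).

One of these two cases occurs if `e` and `e'` are congruent modulo `cutLength`. By conical stability
the possible subpaths lie in boundedly many cones, hence bad scales separated by `cutLength` number
at most `scaleCount`, a constant that depends on `K` and `ε` only (`card_isBadScale_le`). There are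
at most `6 * n` ordered triples to be considered, so that one of `6 * n * scaleCount + 1` candidate
scales is good for all of them (`exists_scale`). The capacity function may be any function that
bounds the number of channels; it is chosen large enough for the margin `4 * (11 * mu + phi n)` to
contain the few sections, at the largest candidate scale, that the argument uses.
-/

namespace CanonicalCylinders

variable {V : Type u} {K : SimpleGraph V}

/-! ### Paths as sequences of vertices -/

/-- The first `n + 1` terms of the sequence `p` are the consecutive vertices of a simplicial
path. -/
def IsVertexPath (K : SimpleGraph V) (p : ℕ → V) (n : ℕ) : Prop :=
  ∀ t, t < n → K.Adj (p t) (p (t + 1))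

/-- The terms of the sequence `g` with indices in `[a, b]` are the consecutive vertices of a
geodesic. -/
def IsGeodesicOn (K : SimpleGraph V) (g : ℕ → V) (a b : ℕ) : Prop :=
  ∀ i j, a ≤ i → i ≤ j → j ≤ b → K.dist (g i) (g j) = j - i

/-- The sequence `g` is, on `[0, |x - y|]`, a geodesic from `x` to `y`. -/
structure IsGeodesicFromTo (K : SimpleGraph V) (g : ℕ → V) (x y : V) : Prop where
  geo : IsGeodesicOn K g 0 (K.dist x y)
  source : g 0 = x
  target : g (K.dist x y) = y

theorem IsVertexPath.mono {p : ℕ → V} {m n : ℕ} (hp : IsVertexPath K p n) (h : m ≤ n) :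
    IsVertexPath K p m :=
  fun t ht => hp t (by omega)

theorem IsVertexPath.shift {p : ℕ → V} {n : ℕ} (hp : IsVertexPath K p n) (s : ℕ) :
    IsVertexPath K (fun t => p (s + t)) (n - s) :=
  fun t ht => hp (s + t) (by omega)

theorem IsVertexPath.reflect {p : ℕ → V} {n s : ℕ} (hp : IsVertexPath K p n) (h : s ≤ n) :
    IsVertexPath K (fun t => p (s - t)) s := by
  intro t ht
  have := hp (s - (t + 1)) (by omega)
  rw [show s - (t + 1) + 1 = s - t by omega] at this
  exact this.symm

theorem IsVertexPath.exists_walk {p : ℕ → V} {n : ℕ} (hp : IsVertexPath K p n) :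
    ∃ q : K.Walk (p 0) (p n), q.length = n ∧ ∀ t ≤ n, q.getVert t = p t := by
  induction n with
  | zero =>
    refine ⟨.nil, rfl, fun t ht => ?_⟩
    rw [Nat.le_zero.1 ht]
    simp
  | succ n ih =>
    obtain ⟨q, hq, hq'⟩ := ih (hp.mono (by omega))
    refine ⟨q.concat (hp n (by omega)), by simp [hq], fun t ht => ?_⟩
    rw [SimpleGraph.Walk.concat_eq_append, SimpleGraph.Walk.getVert_append']
    split_ifs with h
    · exact hq' t (by omega)
    · obtain rfl : t = n + 1 := by omega
      simp [hq]

theorem isVertexPath_getVert {x y : V} (q : K.Walk x y) : IsVertexPath K q.getVert q.length :=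
  fun _ ht => q.adj_getVert_succ ht

theorem IsVertexPath.dist_le {p : ℕ → V} {n : ℕ} (hK : K.Connected) (hp : IsVertexPath K p n)
    {s t : ℕ} (hst : s ≤ t) (ht : t ≤ n) : K.dist (p s) (p t) ≤ t - s := by
  induction t, hst using Nat.le_induction with
  | base => simp
  | succ t hst ih =>
    have h1 := SimpleGraph.dist_eq_one_iff_adj.2 (hp t (by omega))
    have h2 := hK.dist_triangle (u := p s) (v := p t) (w := p (t + 1))
    have := ih (by omega)
    omega

theorem IsGeodesicOn.isVertexPath {g : ℕ → V} {n : ℕ} (hg : IsGeodesicOn K g 0 n) :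
    IsVertexPath K g n := fun t ht =>
  SimpleGraph.dist_eq_one_iff_adj.1 (by rw [hg t (t + 1) (by omega) (by omega) (by omega)]; omega)

/-- A simplicial path that is as long as the distance between its ends is a geodesic. -/
theorem IsVertexPath.isGeodesicOn {p : ℕ → V} {n a b : ℕ} (hK : K.Connected)
    (hp : IsVertexPath K p n) (hb : b ≤ n) (h : b - a ≤ K.dist (p a) (p b)) :
    IsGeodesicOn K p a b := by
  intro i j hi hij hj
  have h1 := hp.dist_le hK (s := a) (t := i) hi (by omega)
  have h2 := hp.dist_le hK (s := i) (t := j) hij (by omega)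
  have h3 := hp.dist_le hK (s := j) (t := b) hj (by omega)
  have h4 := hK.dist_triangle (u := p a) (v := p i) (w := p b)
  have h5 := hK.dist_triangle (u := p i) (v := p j) (w := p b)
  omega

theorem isGeodesicFromTo_getVert (hK : K.Connected) {x y : V} {q : K.Walk x y}
    (hq : IsGeodesicSegment q) : IsGeodesicFromTo K q.getVert x y := by
  have hq' : q.length = K.dist x y := hq
  have hy : q.getVert (K.dist x y) = y := by rw [← hq']; simp
  exact ⟨(isVertexPath_getVert q).isGeodesicOn hK hq'.ge (by simp [hy]), by simp, hy⟩

theorem exists_isGeodesicFromTo (hK : K.Connected) (x y : V) :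
    ∃ g : ℕ → V, IsGeodesicFromTo K g x y := by
  obtain ⟨q, hq⟩ := hK.exists_walk_length_eq_dist x y
  exact ⟨_, isGeodesicFromTo_getVert hK hq⟩

theorem IsGeodesicFromTo.exists_walk {g : ℕ → V} {x y : V} (hg : IsGeodesicFromTo K g x y) :
    ∃ q : K.Walk x y, IsGeodesicSegment q ∧ ∀ t ≤ K.dist x y, q.getVert t = g t := by
  obtain ⟨q, hq, hq'⟩ := hg.geo.isVertexPath.exists_walk
  refine ⟨q.copy hg.source hg.target, ?_, fun t ht => ?_⟩
  · simpa [IsGeodesicSegment] using hq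
  · simpa using hq' t ht

theorem IsGeodesicFromTo.dist_source {g : ℕ → V} {x y : V} (hg : IsGeodesicFromTo K g x y)
    {i : ℕ} (hi : i ≤ K.dist x y) : K.dist x (g i) = i := by
  have := hg.geo 0 i le_rfl (by omega) hi
  rwa [hg.source, Nat.sub_zero] at this

theorem IsGeodesicFromTo.dist_target {g : ℕ → V} {x y : V} (hg : IsGeodesicFromTo K g x y)
    {i : ℕ} (hi : i ≤ K.dist x y) : K.dist (g i) y = K.dist x y - i := by
  have := hg.geo i _ (by omega) hi le_rfl
  rwa [hg.target] at this

/-- Two points of a path at the same distance from `x`, and `E`-close to a geodesic issued from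
`x`, are close to one another. -/
theorem IsGeodesicFromTo.dist_le_of_close {g : ℕ → V} {x y : V} (hK : K.Connected)
    (hg : IsGeodesicFromTo K g x y) {a b : V} {i j E : ℕ} (hi : i ≤ K.dist x y)
    (hj : j ≤ K.dist x y) (ha : K.dist a (g i) ≤ E) (hb : K.dist b (g j) ≤ E)
    (hab : K.dist x a ≤ K.dist x b) : K.dist a b + K.dist x a ≤ K.dist x b + 4 * E := by
  have h1 := hg.dist_source hi
  have h2 := hg.dist_source hj
  have h3 := hK.dist_triangle (u := x) (v := a) (w := g i)
  have h4 := hK.dist_triangle (u := x) (v := b) (w := g j)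
  have h5 := hK.dist_triangle (u := x) (v := g i) (w := a)
  have h6 := hK.dist_triangle (u := x) (v := g j) (w := b)
  have h7 := hK.dist_triangle (u := a) (v := g i) (w := b)
  have h8 := hK.dist_triangle (u := g i) (v := g j) (w := b)
  have e1 := SimpleGraph.dist_comm (G := K) (u := a) (v := g i)
  have e2 := SimpleGraph.dist_comm (G := K) (u := b) (v := g j)
  have h9 : K.dist (g i) (g j) ≤ max i j - min i j := by
    rcases le_total i j with h | h
    · rw [hg.geo i j (by omega) h hj]; omega
    · rw [SimpleGraph.dist_comm, hg.geo j i (by omega) h hi]; omega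
  omega

/-- A sequence of integers starting at most at `a` that moves by at most one at each step cannot
jump over `a`. -/
theorem exists_eq_of_lipschitz {u : ℕ → ℕ} {n a : ℕ} (h0 : u 0 ≤ a) (hn : a ≤ u n)
    (hu : ∀ t < n, u (t + 1) ≤ u t + 1) : ∃ t ≤ n, u t = a := by
  induction n with
  | zero => exact ⟨0, le_rfl, by omega⟩
  | succ n ih =>
    rcases le_or_gt a (u n) with h | h
    · obtain ⟨t, ht, h⟩ := ih h (fun t ht => hu t (by omega))
      exact ⟨t, by omega, h⟩
    · exact ⟨n + 1, le_rfl, by have := hu n (by omega); omega⟩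

theorem IsVertexPath.dist_succ_le {p : ℕ → V} {n : ℕ} (hK : K.Connected)
    (hp : IsVertexPath K p n) (x : V) {t : ℕ} (ht : t < n) :
    K.dist x (p (t + 1)) ≤ K.dist x (p t) + 1 := by
  have h1 := SimpleGraph.dist_eq_one_iff_adj.2 (hp t ht)
  have h2 := hK.dist_triangle (u := x) (v := p t) (w := p (t + 1))
  omega

/-- `Λ`-quasi-geodesics, for an integer `Λ`; the other inequality of the definition holds for
every path. -/
def IsQuasiGeo (K : SimpleGraph V) (Λ : ℕ) (p : ℕ → V) (n : ℕ) : Prop :=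
  ∀ i j, i ≤ j → j ≤ n → j ≤ i + Λ * K.dist (p i) (p j)

theorem IsQuasiGeo.reflect {Λ : ℕ} {p : ℕ → V} {n s : ℕ} (hp : IsQuasiGeo K Λ p n) (h : s ≤ n) :
    IsQuasiGeo K Λ (fun t => p (s - t)) s := by
  intro i j hij hj
  have := hp (s - j) (s - i) (by omega) (by omega)
  rw [SimpleGraph.dist_comm] at this
  dsimp only
  omega

theorem IsQuasiGeo.shift {Λ : ℕ} {p : ℕ → V} {n s : ℕ} (hp : IsQuasiGeo K Λ p n) (h : s ≤ n) :
    IsQuasiGeo K Λ (fun t => p (s + t)) (n - s) := by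
  intro i j hij hj
  have := hp (s + i) (s + j) (by omega) (by omega)
  dsimp only
  omega

/-! ### Stability of quasi-geodesics -/

/-- Thin triangles are slim. -/
theorem slim_of_isHyperbolicGraph {δ : ℕ} (hK : IsHyperbolicGraph δ K) {a b w : V} (m : V)
    (hw : K.dist a w + K.dist w b = K.dist a b) :
    ∃ w', K.dist w w' ≤ δ ∧ (K.dist a w' + K.dist w' m = K.dist a m ∨
      K.dist m w' + K.dist w' b = K.dist m b) := by
  have hc := hK.1
  have c1 := SimpleGraph.dist_comm (G := K) (u := b) (v := m)
  have c2 := SimpleGraph.dist_comm (G := K) (u := a) (v := b)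
  have c3 := SimpleGraph.dist_comm (G := K) (u := a) (v := m)
  have c4 := SimpleGraph.dist_comm (G := K) (u := w) (v := b)
  have c5 := SimpleGraph.dist_comm (G := K) (u := w) (v := a)
  have t1 := hc.dist_triangle (u := a) (v := m) (w := b)
  have t2 := hc.dist_triangle (u := b) (v := a) (w := m)
  have t3 := hc.dist_triangle (u := a) (v := b) (w := m)
  rcases le_total (2 * K.dist a w + K.dist b m) (K.dist a b + K.dist a m) with h | h
  · obtain ⟨g, hg⟩ := exists_isGeodesicFromTo hc a m
    have hi : K.dist a w ≤ K.dist a m := by omega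
    refine ⟨g (K.dist a w), ?_, Or.inl ?_⟩
    · refine hK.2 a b m _ _ hw ?_ (hg.dist_source hi).symm ?_
      · rw [hg.dist_source hi, hg.dist_target hi]; omega
      · have : (2 * K.dist a w + K.dist b m : ℝ) ≤ K.dist a b + K.dist a m := by exact_mod_cast h
        unfold gromovProduct
        linarith
    · rw [hg.dist_source hi, hg.dist_target hi]; omega
  · obtain ⟨g, hg⟩ := exists_isGeodesicFromTo hc b m
    have hi : K.dist b w ≤ K.dist b m := by omega
    refine ⟨g (K.dist b w), ?_, Or.inr ?_⟩
    · refine hK.2 b a m _ _ (by omega) ?_ (hg.dist_source hi).symm ?_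
      · rw [hg.dist_source hi, hg.dist_target hi]; omega
      · have : (2 * K.dist b w + K.dist a m : ℝ) ≤ K.dist b a + K.dist b m := by
          exact_mod_cast (by omega : 2 * K.dist b w + K.dist a m ≤ K.dist b a + K.dist b m)
        unfold gromovProduct
        linarith
    · have h1 := hg.dist_source hi
      have h2 := hg.dist_target hi
      have c6 := SimpleGraph.dist_comm (G := K) (u := m) (v := g (K.dist b w))
      have c7 := SimpleGraph.dist_comm (G := K) (u := b) (v := g (K.dist b w))
      omega

/-- A path that leaves a large neighborhood of a geodesic with the same ends has exponential
length. -/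
theorem exists_dist_le_of_isVertexPath {δ : ℕ} (hK : IsHyperbolicGraph δ K)
    {p : ℕ → V} {n : ℕ} (hp : IsVertexPath K p n) (k : ℕ) :
    ∀ (s t : ℕ) (w : V), s ≤ t → t ≤ n → t ≤ s + 2 ^ k →
      K.dist (p s) w + K.dist w (p t) = K.dist (p s) (p t) →
      ∃ r, s ≤ r ∧ r ≤ t ∧ K.dist w (p r) ≤ δ * k + 1 := by
  have hc := hK.1
  induction k with
  | zero =>
    intro s t w hst ht hk hw
    have := hp.dist_le hc hst ht
    exact ⟨s, le_rfl, hst, by rw [SimpleGraph.dist_comm]; simp at hk ⊢; omega⟩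
  | succ k ih =>
    intro s t w hst ht hk hw
    obtain ⟨m, hm1, hm2, hm3, hm4⟩ : ∃ m, s ≤ m ∧ m ≤ t ∧ m ≤ s + 2 ^ k ∧ t ≤ m + 2 ^ k :=
      ⟨(s + t) / 2, by omega, by omega, by rw [pow_succ] at hk; omega,
        by rw [pow_succ] at hk; omega⟩
    obtain ⟨w', hww', h⟩ := slim_of_isHyperbolicGraph hK (p m) hw
    have key : ∃ r, s ≤ r ∧ r ≤ t ∧ K.dist w' (p r) ≤ δ * k + 1 := by
      rcases h with h | h
      · obtain ⟨r, h1, h2, h3⟩ := ih s m w' hm1 (by omega) hm3 h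
        exact ⟨r, by omega, by omega, h3⟩
      · obtain ⟨r, h1, h2, h3⟩ := ih m t w' hm2 (by omega) hm4 h
        exact ⟨r, by omega, by omega, h3⟩
    obtain ⟨r, h1, h2, h3⟩ := key
    have := hc.dist_triangle (u := w) (v := w') (w := p r)
    exact ⟨r, h1, h2, by rw [Nat.mul_succ]; omega⟩

/-- A quantity that is at most logarithmic in itself is bounded. -/
theorem exists_bound_of_le_log (δ A : ℕ) :
    ∃ D, ∀ M : ℕ, (∀ k, A * M ≤ 2 ^ k → M ≤ δ * k + 2 * δ + 1) → M ≤ D := by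
  refine ⟨2 ^ (2 * (δ * (A + 10) + 10)), fun M hM => ?_⟩
  by_contra! hlt
  have hM0 : M ≠ 0 := Nat.ne_of_gt (lt_of_le_of_lt (Nat.zero_le _) hlt)
  set κ := Nat.log 2 M with hκ
  have h1 : 2 ^ κ ≤ M := Nat.pow_log_le_self 2 hM0
  have h2 : M < 2 ^ (κ + 1) := Nat.lt_pow_succ_log_self (by norm_num) M
  have h3 : 2 * (δ * (A + 10) + 10) ≤ κ := Nat.le_log_of_pow_le (by norm_num) hlt.le
  have h4 : A * M ≤ 2 ^ (A + (κ + 1)) := by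
    rw [pow_add]
    exact Nat.mul_le_mul Nat.lt_two_pow_self.le h2.le
  have h5 := hM _ h4
  obtain ⟨h, hh⟩ : ∃ h, h = κ / 2 := ⟨_, rfl⟩
  have h6 : h * h ≤ 2 ^ κ := by
    calc h * h ≤ 2 ^ h * 2 ^ h := Nat.mul_le_mul Nat.lt_two_pow_self.le Nat.lt_two_pow_self.le
      _ = 2 ^ (h + h) := (pow_add _ _ _).symm
      _ ≤ 2 ^ κ := Nat.pow_le_pow_right (by norm_num) (by omega)
  have h7 : δ * (A + 10) + 10 ≤ h := by omega
  have h8 : δ * (A + (κ + 1)) ≤ δ * (A + 2 * h + 2) := Nat.mul_le_mul_left _ (by omega)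
  have h9 : h * (δ * (A + 10) + 10) ≤ h * h := Nat.mul_le_mul_left _ h7
  have h10 : δ * A ≤ h * (δ * A) := Nat.le_mul_of_pos_left _ (by omega)
  have h11 : δ ≤ h * δ := Nat.le_mul_of_pos_left _ (by omega)
  have e1 : h * (δ * (A + 10) + 10) = h * (δ * A) + 10 * (h * δ) + 10 * h := by ring
  have e2 : δ * (A + 2 * h + 2) = δ * A + 2 * (h * δ) + 2 * δ := by ring
  omega

/-- A geodesic stays close to any quasi-geodesic with the same ends. -/
theorem exists_geodesic_near_quasiGeodesic (δ Λ : ℕ) :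
    ∃ D, ∀ (V : Type u) (K : SimpleGraph V), IsHyperbolicGraph δ K →
      ∀ (x y : V) (g p : ℕ → V) (n : ℕ), IsGeodesicFromTo K g x y → IsVertexPath K p n →
        p 0 = x → p n = y → IsQuasiGeo K Λ p n →
        ∀ i ≤ K.dist x y, ∃ r ≤ n, K.dist (g i) (p r) ≤ D := by
  obtain ⟨D, hD⟩ := exists_bound_of_le_log δ (6 * Λ)
  refine ⟨D, fun V K hK x y g p n hg hp hp0 hpn hq => ?_⟩
  have hc := hK.1
  -- `M` is the largest distance from a vertex of the geodesic to the quasi-geodesic.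
  obtain ⟨M, hM, i, hi, hiM⟩ : ∃ M, (∀ j ≤ K.dist x y, ∃ r ≤ n, K.dist (g j) (p r) ≤ M) ∧
      ∃ i ≤ K.dist x y, ∀ r ≤ n, M ≤ K.dist (g i) (p r) := by
    classical
    have hex : ∃ M, ∀ j ≤ K.dist x y, ∃ r ≤ n, K.dist (g j) (p r) ≤ M :=
      ⟨K.dist x y, fun j hj => ⟨0, by omega, by
        rw [hp0, SimpleGraph.dist_comm, hg.dist_source hj]; exact hj⟩⟩
    refine ⟨Nat.find hex, Nat.find_spec hex, ?_⟩
    rcases Nat.eq_zero_or_pos (Nat.find hex) with h | h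
    · exact ⟨0, by omega, fun r _ => by omega⟩
    · have := Nat.find_min hex (Nat.sub_lt h one_pos)
      push Not at this
      obtain ⟨j, hj, hj'⟩ := this
      exact ⟨j, hj, fun r hr => by have := hj' r hr; omega⟩
  suffices hMD : M ≤ D by
    intro j hj
    obtain ⟨r, hr, h⟩ := hM j hj
    exact ⟨r, hr, h.trans hMD⟩
  refine hD M fun k hk => ?_
  -- The vertices `g a` and `g b`, at distance `2 * M` from the farthest vertex `g i` if possible, are
  -- at distance at most `M` from `p`. The geodesics that join them to `p` are not close to `g i`, so
  -- that `g i` is close to a geodesic between two vertices of `p` at distance at most `6 * M`; the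
  -- part of `p` between them is at distance at least about `M` and has length linear in `M`.
  obtain ⟨a, ha⟩ : ∃ a, a = i - 2 * M := ⟨_, rfl⟩
  obtain ⟨b, hb⟩ : ∃ b, b = min (i + 2 * M) (K.dist x y) := ⟨_, rfl⟩
  have da : K.dist (g i) (g a) = i - a := by
    rw [SimpleGraph.dist_comm, hg.geo a i (by omega) (by omega) (by omega)]
  have db : K.dist (g i) (g b) = b - i := hg.geo i b (by omega) (by omega) (by omega)
  have dab : K.dist (g a) (g b) = b - a := hg.geo a b (by omega) (by omega) (by omega)
  obtain ⟨ra, hra, hra', hA⟩ : ∃ r ≤ n, K.dist (g a) (p r) ≤ M ∧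
      ∀ w, K.dist (g a) w + K.dist w (p r) = K.dist (g a) (p r) → M ≤ K.dist (g i) w := by
    rcases le_or_gt (2 * M) i with h | h
    · obtain ⟨r, hr, hr'⟩ := hM a (by omega)
      refine ⟨r, hr, hr', fun w hw => ?_⟩
      have := hc.dist_triangle (u := g i) (v := w) (w := g a)
      rw [SimpleGraph.dist_comm (u := w)] at this
      omega
    · have ha0 : a = 0 := by omega
      have h0 : g a = p 0 := by rw [ha0, hg.source, hp0]
      refine ⟨0, by omega, by rw [h0]; simp, fun w hw => ?_⟩
      rw [h0, SimpleGraph.dist_self] at hw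
      have : p 0 = w := hc.dist_eq_zero_iff.1 (by omega)
      exact this ▸ hiM 0 (by omega)
  obtain ⟨rb, hrb, hrb', hB⟩ : ∃ r ≤ n, K.dist (g b) (p r) ≤ M ∧
      ∀ w, K.dist (p r) w + K.dist w (g b) = K.dist (p r) (g b) → M ≤ K.dist (g i) w := by
    rcases le_or_gt (i + 2 * M) (K.dist x y) with h | h
    · obtain ⟨r, hr, hr'⟩ := hM b (by omega)
      refine ⟨r, hr, hr', fun w hw => ?_⟩
      have := hc.dist_triangle (u := g i) (v := w) (w := g b)
      rw [SimpleGraph.dist_comm (v := g b) (u := p r)] at hw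
      omega
    · have hb0 : b = K.dist x y := by omega
      have h0 : g b = p n := by rw [hb0, hg.target, hpn]
      refine ⟨n, le_rfl, by rw [h0]; simp, fun w hw => ?_⟩
      rw [h0, SimpleGraph.dist_self] at hw
      have : p n = w := hc.dist_eq_zero_iff.1 (by omega)
      exact this ▸ hiM n le_rfl
  have hab : K.dist (p ra) (p rb) ≤ 6 * M := by
    have h1 := hc.dist_triangle (u := p ra) (v := g a) (w := p rb)
    have h2 := hc.dist_triangle (u := g a) (v := g b) (w := p rb)
    rw [SimpleGraph.dist_comm (u := p ra) (v := g a)] at h1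
    omega
  obtain ⟨w₁, hw₁, h₁⟩ := slim_of_isHyperbolicGraph hK (a := g a) (b := g b) (w := g i) (p ra)
    (by rw [SimpleGraph.dist_comm, da, db, dab]; omega)
  rcases h₁ with h₁ | h₁
  · have := hA w₁ h₁
    omega
  obtain ⟨w₂, hw₂, h₂⟩ := slim_of_isHyperbolicGraph hK (p rb) h₁
  have hw := hc.dist_triangle (u := g i) (v := w₁) (w := w₂)
  rcases h₂ with h₂ | h₂
  · have hlen : 6 * Λ * M = Λ * (6 * M) := by ring
    have hle := Nat.mul_le_mul_left Λ hab
    obtain ⟨r, hr, hr'⟩ : ∃ r ≤ n, K.dist w₂ (p r) ≤ δ * k + 1 := by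
      rcases le_total ra rb with h | h
      · have := hq ra rb h hrb
        obtain ⟨r, -, h2, h3⟩ :=
          exists_dist_le_of_isVertexPath hK hp k ra rb w₂ h hrb (by omega) h₂
        exact ⟨r, by omega, h3⟩
      · have := hq rb ra h hra
        rw [SimpleGraph.dist_comm] at this
        obtain ⟨r, -, h2, h3⟩ :=
          exists_dist_le_of_isVertexPath hK hp k rb ra w₂ h hra (by omega) (by
            rw [SimpleGraph.dist_comm (u := p rb), SimpleGraph.dist_comm (v := p ra),
              SimpleGraph.dist_comm (u := p rb)]
            omega)
        exact ⟨r, by omega, h3⟩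
    have h3 := hiM r hr
    have h4 := hc.dist_triangle (u := g i) (v := w₂) (w := p r)
    omega
  · have := hB w₂ h₂
    omega

/-- The Morse lemma: a quasi-geodesic stays close to any geodesic with the same ends. -/
theorem exists_morse_constant (δ Λ : ℕ) :
    ∃ D, ∀ (V : Type u) (K : SimpleGraph V), IsHyperbolicGraph δ K →
      ∀ (x y : V) (g p : ℕ → V) (n : ℕ), IsGeodesicFromTo K g x y → IsVertexPath K p n →
        p 0 = x → p n = y → IsQuasiGeo K Λ p n →
        ∀ t ≤ n, ∃ i ≤ K.dist x y, K.dist (p t) (g i) ≤ D := by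
  obtain ⟨D, hD⟩ := exists_geodesic_near_quasiGeodesic.{u} δ Λ
  refine ⟨D + Λ * (2 * D + 1), fun V K hK x y g p n hg hp hp0 hpn hq t ht => ?_⟩
  have hc := hK.1
  -- `p (θ i)` is close to `g i`; any instant lies between `θ j` and `θ (j + 1)` for some `j`.
  choose! θ hθn hθ using hD V K hK x y g p n hg hp hp0 hpn hq
  have hΛ : Λ * D ≤ Λ * (2 * D + 1) := Nat.mul_le_mul_left _ (by omega)
  rcases le_or_gt t (θ 0) with h0 | h0
  · refine ⟨0, by omega, ?_⟩
    have h1 := hq 0 (θ 0) (by omega) (hθn 0 (by omega))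
    have h2 := hθ 0 (by omega)
    rw [hg.source] at h2 ⊢
    rw [hp0] at h1
    have h3 := hp.dist_le hc (s := 0) (t := t) (by omega) ht
    rw [hp0, SimpleGraph.dist_comm] at h3
    have h4 := Nat.mul_le_mul_left Λ h2
    omega
  by_cases hN : θ (K.dist x y) ≤ t
  · refine ⟨K.dist x y, le_rfl, ?_⟩
    have h1 := hq _ n (hθn _ le_rfl) le_rfl
    have h2 := hθ _ le_rfl
    rw [hg.target] at h2 ⊢
    rw [hpn, SimpleGraph.dist_comm (u := p (θ (K.dist x y))) (v := y)] at h1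
    have h3 := hp.dist_le hc ht le_rfl
    rw [hpn] at h3
    have h4 := Nat.mul_le_mul_left Λ h2
    omega
  · classical
    have hex : ∃ i, i ≤ K.dist x y ∧ t < θ i := ⟨_, le_rfl, by omega⟩
    obtain ⟨hi, hi'⟩ := Nat.find_spec hex
    have hpos : Nat.find hex ≠ 0 := fun h => by rw [h] at hi'; omega
    obtain ⟨j, hj⟩ := Nat.exists_eq_succ_of_ne_zero hpos
    have hj' := Nat.find_min hex (m := j) (by omega)
    rw [hj, Nat.succ_eq_add_one] at hi hi'
    have hjt : θ j ≤ t := by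
      by_contra! h
      exact hj' ⟨by omega, h⟩
    refine ⟨j, by omega, ?_⟩
    have h1 := hθ j (by omega)
    have h2 := hθ (j + 1) hi
    have h3 := hg.geo j (j + 1) (by omega) (by omega) hi
    have h4 := hc.dist_triangle (u := p (θ j)) (v := g j) (w := p (θ (j + 1)))
    have h5 := hc.dist_triangle (u := g j) (v := g (j + 1)) (w := p (θ (j + 1)))
    have h6 := hq (θ j) (θ (j + 1)) (by omega) (hθn _ hi)
    have h7 := hp.dist_le hc hjt ht
    have h8 := hc.dist_triangle (u := p t) (v := p (θ j)) (w := g j)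
    rw [SimpleGraph.dist_comm (u := p t) (v := p (θ j)),
      SimpleGraph.dist_comm (u := p (θ j)) (v := g j)] at h8
    rw [SimpleGraph.dist_comm (u := p (θ j)) (v := g j)] at h4
    have h9 := Nat.mul_le_mul_left Λ (show K.dist (p (θ j)) (p (θ (j + 1))) ≤ 2 * D + 1 by omega)
    omega

/-! ### Conical stability of quasi-geodesics -/

/-- There is a path of length at most `L` from `a` to `b` that avoids the vertex `u`. -/
def IsJoinedAvoiding (K : SimpleGraph V) (u : V) (L : ℕ) (a b : V) : Prop :=
  ∃ q : K.Walk a b, u ∉ q.support ∧ q.length ≤ L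

theorem IsJoinedAvoiding.symm {u a b : V} {L : ℕ} (h : IsJoinedAvoiding K u L a b) :
    IsJoinedAvoiding K u L b a := by
  obtain ⟨q, h1, h2⟩ := h
  exact ⟨q.reverse, by simpa using h1, by simpa using h2⟩

theorem IsJoinedAvoiding.trans {u a b c : V} {L M : ℕ} (h : IsJoinedAvoiding K u L a b)
    (h' : IsJoinedAvoiding K u M b c) : IsJoinedAvoiding K u (L + M) a c := by
  obtain ⟨q, h1, h2⟩ := h
  obtain ⟨q', h1', h2'⟩ := h'
  refine ⟨q.append q', ?_, by rw [SimpleGraph.Walk.length_append]; omega⟩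
  rw [SimpleGraph.Walk.mem_support_append_iff]
  tauto

theorem IsJoinedAvoiding.dist_le {u a b : V} {L : ℕ} (h : IsJoinedAvoiding K u L a b) :
    K.dist a b ≤ L := by
  obtain ⟨q, -, h2⟩ := h
  exact (SimpleGraph.dist_le q).trans h2

theorem IsJoinedAvoiding.angleAt_le {u a b : V} {L M : ℕ} (h : IsJoinedAvoiding K u L a b)
    (hM : L ≤ M) : angleAt K u a b ≤ (M : ℕ∞) := by
  obtain ⟨q, h1, h2⟩ := h
  exact (iInf₂_le q h1).trans (by exact_mod_cast h2.trans hM)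

theorem IsVertexPath.isJoinedAvoiding {p : ℕ → V} {n s t : ℕ} (hp : IsVertexPath K p n)
    (hst : s ≤ t) (ht : t ≤ n) {u : V} (hu : ∀ r, s ≤ r → r ≤ t → p r ≠ u) :
    IsJoinedAvoiding K u (t - s) (p s) (p t) := by
  obtain ⟨q, hq, hq'⟩ := ((hp.shift s).mono (show t - s ≤ n - s by omega)).exists_walk
  refine ⟨q.copy (by simp) (by rw [Nat.add_sub_cancel' hst]), ?_, by simp [hq]⟩
  rw [SimpleGraph.Walk.support_copy, SimpleGraph.Walk.mem_support_iff_exists_getVert]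
  rintro ⟨r, hr, hr'⟩
  rw [hq' r (by omega)] at hr
  exact hu (s + r) (by omega) (by omega) hr

theorem isJoinedAvoiding_of_dist_ne (hK : K.Connected) {a b u : V}
    (h : K.dist a b < K.dist a u + K.dist u b) :
    IsJoinedAvoiding K u (K.dist a b) a b := by
  obtain ⟨g, hg⟩ := exists_isGeodesicFromTo hK a b
  have := hg.geo.isVertexPath.isJoinedAvoiding (Nat.zero_le _) le_rfl (u := u) (by
    rintro r - hr rfl
    rw [hg.dist_source hr, hg.dist_target hr] at h
    omega)
  rwa [hg.source, hg.target, Nat.sub_zero] at this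

theorem IsGeodesicOn.ne {g : ℕ → V} {a b : ℕ} (hg : IsGeodesicOn K g a b) {i j : ℕ}
    (hi : a ≤ i) (hij : i < j) (hj : j ≤ b) : g i ≠ g j := by
  intro h
  have := hg i j hi hij.le hj
  rw [h, SimpleGraph.dist_self] at this
  omega

/-- From a vertex close to `u`, a quasi-geodesic that avoids `u`, stays close to `g` and ends on
`g` provides a short way to `g` that avoids `u`. -/
theorem IsQuasiGeo.exists_isJoinedAvoiding {Λ D N n : ℕ} (hΛ : 0 < Λ) {g p : ℕ → V} {u : V}
    (hK : K.Connected) (hp : IsVertexPath K p n) (hq : IsQuasiGeo K Λ p n)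
    (hclose : ∀ t ≤ n, ∃ i ≤ N, K.dist (p t) (g i) ≤ D) (hend : ∃ i ≤ N, p n = g i)
    (hu : K.dist (p 0) u ≤ D) (hpu : ∀ t ≤ n, p t ≠ u) :
    ∃ i ≤ N, g i ≠ u ∧ IsJoinedAvoiding K u (Λ * (2 * D + 1) + D) (p 0) (g i) := by
  obtain ⟨T, hT⟩ : ∃ T, T = Λ * (2 * D + 1) := ⟨_, rfl⟩
  rw [← hT]
  rcases le_or_gt n T with h | h
  · obtain ⟨i, hi, hi'⟩ := hend
    obtain ⟨q, h1, h2⟩ := hp.isJoinedAvoiding (Nat.zero_le n) le_rfl fun r _ => hpu r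
    exact ⟨i, hi, hi' ▸ hpu n le_rfl, hi' ▸ ⟨q, h1, by omega⟩⟩
  · obtain ⟨i, hi, hi'⟩ := hclose T h.le
    have h1 := hq 0 T (by omega) h.le
    have h2 : 2 * D + 1 ≤ K.dist (p 0) (p T) := by
      refine Nat.le_of_mul_le_mul_left ?_ hΛ
      omega
    have h3 := hK.dist_triangle (u := p 0) (v := u) (w := p T)
    rw [SimpleGraph.dist_comm (u := u)] at h3
    refine ⟨i, hi, ?_, ?_⟩
    · rintro rfl
      omega
    · obtain ⟨q, h4, h5⟩ := (hp.isJoinedAvoiding (Nat.zero_le T) h.le fun r _ h =>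
        hpu r (by omega)).trans (isJoinedAvoiding_of_dist_ne hK (a := p T) (b := g i) (by omega))
      exact ⟨q, h4, by omega⟩

/-- The same for a vertex in the middle of a quasi-geodesic: it passes at most once through `u`,
so that one of its two halves avoids `u`. -/
theorem IsQuasiGeo.exists_isJoinedAvoiding_of_ne {Λ D N n : ℕ} (hΛ : 0 < Λ) {g p : ℕ → V}
    {u : V} (hK : K.Connected) (hp : IsVertexPath K p n) (hq : IsQuasiGeo K Λ p n)
    (hclose : ∀ t ≤ n, ∃ i ≤ N, K.dist (p t) (g i) ≤ D) (hstart : ∃ i ≤ N, p 0 = g i)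
    (hend : ∃ i ≤ N, p n = g i) {t : ℕ} (ht : t ≤ n) (hu : K.dist (p t) u ≤ D) (hut : p t ≠ u) :
    ∃ i ≤ N, g i ≠ u ∧ IsJoinedAvoiding K u (Λ * (2 * D + 1) + D) (p t) (g i) := by
  by_cases h : ∀ r, t ≤ r → r ≤ n → p r ≠ u
  · exact (hq.shift ht).exists_isJoinedAvoiding hΛ (g := g) (N := N) hK (hp.shift t)
      (fun r hr => hclose _ (by omega)) (by simpa [Nat.add_sub_cancel' ht] using hend) hu
      (fun r hr => h _ (by omega) (by omega))
  · push Not at h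
    obtain ⟨r, hr, hrn, rfl⟩ := h
    refine (hq.reflect ht).exists_isJoinedAvoiding hΛ (g := g) (N := N) hK (hp.reflect ht)
      (fun r hr => hclose _ (by omega)) (by simpa using hstart) hu (fun r' hr' he => ?_)
    have h1 := hq (t - r') r (by omega) hrn
    rw [he, SimpleGraph.dist_self] at h1
    obtain rfl : t = r := by omega
    exact hut rfl

/-- Conical stability: in a hyperbolic graph, the vertices of a quasi-geodesic lie in cones of
bounded radius and angle centered at edges of any geodesic with the same ends. The angles along a
shortest path `[v, w]` from the geodesic to the vertex `w` are small, since the quasi-geodesic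
provides, at every vertex of `[v, w]`, a detour of bounded length. -/
theorem exists_conical_constant (δ Λ : ℕ) (hΛ : 0 < Λ) :
    ∃ N, ∀ ε, N ≤ ε → ∀ (V : Type u) (K : SimpleGraph V), IsHyperbolicGraph δ K →
      ∀ (x y : V) (g p : ℕ → V) (n : ℕ), x ≠ y → IsGeodesicFromTo K g x y →
        IsVertexPath K p n → p 0 = x → p n = y → IsQuasiGeo K Λ p n →
        ∀ t ≤ n, ∃ i < K.dist x y, p t ∈ cone K ε ε (g i) (g (i + 1)) ∨
          p t ∈ cone K ε ε (g (i + 1)) (g i) := by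
  obtain ⟨D, hD⟩ := exists_morse_constant.{u} δ Λ
  refine ⟨2 * (Λ * (2 * D + 1)) + 5 * D, ?_⟩
  intro ε hε V K hK x y g p n hxy hg hp hp0 hpn hq t ht
  have hc := hK.1
  have hclose := hD V K hK x y g p n hg hp hp0 hpn hq
  obtain ⟨T, hT⟩ : ∃ T, T = Λ * (2 * D + 1) := ⟨_, rfl⟩
  rw [← hT] at hε
  have hN : 0 < K.dist x y := hc.pos_dist_of_ne hxy
  obtain ⟨i₀, hi₀, hmin⟩ : ∃ i ≤ K.dist x y, ∀ j ≤ K.dist x y,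
      K.dist (p t) (g i) ≤ K.dist (p t) (g j) := by
    obtain ⟨i, hi, h⟩ := Finset.exists_min_image (Finset.range (K.dist x y + 1))
      (fun i => K.dist (p t) (g i)) ⟨0, by simp⟩
    refine ⟨i, by simpa [Nat.lt_succ_iff] using hi, fun j hj => h j ?_⟩
    simpa [Nat.lt_succ_iff] using hj
  have hd : K.dist (p t) (g i₀) ≤ D := by
    obtain ⟨i, hi, h⟩ := hclose t ht
    exact (hmin i hi).trans h
  rw [SimpleGraph.dist_comm] at hd
  obtain ⟨γ, hγ⟩ := exists_isGeodesicFromTo hc (g i₀) (p t)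
  obtain ⟨q, hq1, hq2⟩ := hγ.exists_walk
  have hqlen : q.length = K.dist (g i₀) (p t) := hq1
  have escape := fun (u : V) => hq.exists_isJoinedAvoiding_of_ne (g := g) (u := u)
    (N := K.dist x y) hΛ hc hp hclose ⟨0, by omega, by rw [hp0, hg.source]⟩
    ⟨_, le_rfl, by rw [hpn, hg.target]⟩ ht
  rw [← hT] at escape
  -- The angles of the shortest path at its interior vertices.
  have hmax : maxAngle q ≤ (ε : ℕ∞) := by
    refine iSup₂_le fun k hk => ?_
    rw [hqlen] at hk
    rw [hq2 _ (by omega), hq2 _ (by omega), hq2 _ (by omega)]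
    have hku := hγ.dist_target hk.2.le
    rw [SimpleGraph.dist_comm] at hku
    obtain ⟨j, hj, -, hju⟩ := escape (γ k) (by omega) (fun h => by
      rw [← h, SimpleGraph.dist_self] at hku; omega)
    have h1 : IsJoinedAvoiding K (γ k) (k - 1 - 0) (γ 0) (γ (k - 1)) :=
      hγ.geo.isVertexPath.isJoinedAvoiding (by omega) (by omega)
        fun r _ hr => hγ.geo.ne (by omega) (by omega) (by omega)
    have h2 : IsJoinedAvoiding K (γ k) (K.dist (g i₀) (p t) - (k + 1)) (γ (k + 1))
        (γ (K.dist (g i₀) (p t))) :=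
      hγ.geo.isVertexPath.isJoinedAvoiding (by omega) (by omega)
        fun r hr hr' => (hγ.geo.ne (by omega) (by omega) (by omega)).symm
    -- The geodesic `g` avoids `γ k`, which is closer to `p t` than any vertex of `g`.
    have hgk : ∀ r ≤ K.dist x y, g r ≠ γ k := by
      intro r hr h
      have h3 := hmin r hr
      rw [h, SimpleGraph.dist_comm] at h3
      omega
    have h3 := hju.dist_le
    have h4 := hc.dist_triangle (u := g i₀) (v := p t) (w := g j)
    have h5 : IsJoinedAvoiding K (γ k) (K.dist (g i₀) (g j)) (g i₀) (g j) := by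
      rcases le_total i₀ j with h | h
      · rw [hg.geo i₀ j (by omega) h hj]
        exact hg.geo.isVertexPath.isJoinedAvoiding h hj fun r _ hr => hgk r (by omega)
      · rw [SimpleGraph.dist_comm, hg.geo j i₀ (by omega) h hi₀]
        exact (hg.geo.isVertexPath.isJoinedAvoiding h hi₀ fun r _ hr => hgk r (by omega)).symm
    rw [hγ.source] at h1
    rw [hγ.target] at h2
    exact (((h1.symm.trans h5).trans hju.symm).trans h2.symm).angleAt_le (by omega)
  -- It remains to choose the edge of `g` at `g i₀`.
  have hcone : ∀ b : V, (0 < q.length → angleAt K (g i₀) b (q.getVert 1) ≤ (ε : ℕ∞)) →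
      p t ∈ cone K ε ε (g i₀) b := fun b hb => ⟨by omega, q, hq1, hmax, hb⟩
  rcases Nat.eq_zero_or_pos q.length with h0 | h0
  · rcases Nat.eq_zero_or_pos i₀ with h | h
    · refine ⟨0, hN, Or.inl ?_⟩
      rw [← h]
      exact hcone _ fun h => by omega
    · refine ⟨i₀ - 1, by omega, Or.inr ?_⟩
      rw [Nat.sub_add_cancel h]
      exact hcone _ fun h => by omega
  · obtain ⟨j, hj, hjne, hju⟩ := escape (g i₀) (by rw [SimpleGraph.dist_comm]; exact hd)
      (fun h => by rw [hqlen, h, SimpleGraph.dist_self] at h0; omega)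
    have h1 : IsJoinedAvoiding K (g i₀) (K.dist (g i₀) (p t) - 1) (γ 1)
        (γ (K.dist (g i₀) (p t))) :=
      hγ.geo.isVertexPath.isJoinedAvoiding (by omega) (by omega)
        fun r hr hr' h => (hγ.geo.ne (i := 0) (j := r) (by omega) (by omega) (by omega))
          (by rw [h, hγ.source])
    rw [hγ.target] at h1
    have h3 := hju.dist_le
    have h4 := hc.dist_triangle (u := g i₀) (v := p t) (w := g j)
    rw [← hq2 1 (by omega)] at h1
    rcases lt_or_gt_of_ne (show i₀ ≠ j from fun h => hjne (by rw [h])) with h | h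
    · refine ⟨i₀, by omega, Or.inl (hcone _ fun _ => ?_)⟩
      rw [hg.geo i₀ j (by omega) h.le hj] at h4
      have h5 : IsJoinedAvoiding K (g i₀) (j - (i₀ + 1)) (g (i₀ + 1)) (g j) :=
        hg.geo.isVertexPath.isJoinedAvoiding (by omega) hj
          fun r hr hr' => (hg.geo.ne (by omega) (by omega) (by omega)).symm
      exact ((h5.trans hju.symm).trans h1.symm).angleAt_le (by omega)
    · refine ⟨i₀ - 1, by omega, Or.inr ?_⟩
      rw [Nat.sub_add_cancel (by omega)]
      refine hcone _ fun _ => ?_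
      rw [SimpleGraph.dist_comm (u := g i₀) (v := g j), hg.geo j i₀ (by omega) h.le hi₀] at h4
      have h5 : IsJoinedAvoiding K (g i₀) (i₀ - 1 - j) (g j) (g (i₀ - 1)) :=
        hg.geo.isVertexPath.isJoinedAvoiding (by omega) (by omega)
          fun r hr hr' => hg.geo.ne (by omega) (by omega) (by omega)
      exact ((h5.symm.trans hju.symm).trans h1.symm).angleAt_le (by omega)

theorem mem_edges_getVert {x y : V} (g : K.Walk x y) {i : ℕ} (hi : i < g.length) :
    s(g.getVert i, g.getVert (i + 1)) ∈ g.edges :=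
  SimpleGraph.Walk.adj_toSubgraph_iff_mem_edges.1 (g.toSubgraph_adj_getVert hi)

theorem isQuasiGeo_of_isQuasiGeodesic {x y : V} {q : K.Walk x y} {Λ : ℕ} (hΛ : 0 < Λ)
    (hq : IsQuasiGeodesic q (Λ : ℝ)) : IsQuasiGeo K Λ q.getVert q.length := by
  intro i j hij hj
  have h := (hq i j (Nat.zero_le i) hij hj).1
  rw [div_le_iff₀ (by exact_mod_cast hΛ)] at h
  have : (j : ℝ) ≤ ((i + Λ * K.dist (q.getVert i) (q.getVert j) : ℕ) : ℝ) := by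
    push_cast
    linarith
  exact_mod_cast this

theorem exists_isConicalStabilityConstant (δ Λ : ℕ) (hΛ : 0 < Λ) :
    ∃ N, ∀ ε, N ≤ ε → IsConicalStabilityConstant.{u} (Λ : ℝ) δ ε := by
  obtain ⟨N, hN⟩ := exists_conical_constant.{u} δ Λ hΛ
  refine ⟨N, fun ε hε V K hK x y g q hxy hg hq w hw => ?_⟩
  obtain ⟨t, rfl, ht⟩ := SimpleGraph.Walk.mem_support_iff_exists_getVert.1 hw
  have hg' : g.length = K.dist x y := hg
  obtain ⟨i, hi, h⟩ := hN ε hε V K hK x y g.getVert q.getVert q.length hxy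
    (isGeodesicFromTo_getVert hK.1 hg) (isVertexPath_getVert q) (by simp) (by simp)
    (isQuasiGeo_of_isQuasiGeodesic hΛ hq) t ht
  have he := mem_edges_getVert g (hg' ▸ hi)
  rcases h with h | h
  · exact ⟨_, _, he, h⟩
  · exact ⟨_, _, Sym2.eq_swap ▸ he, h⟩

/-! ### Finiteness of cones and of channels -/

theorem isJoinedAvoiding_of_angleAt_le {a b c : V} {θ : ℕ} (h : angleAt K a b c ≤ (θ : ℕ∞)) :
    IsJoinedAvoiding K a θ b c := by
  by_contra hn
  have h1 : ((θ + 1 : ℕ) : ℕ∞) ≤ angleAt K a b c := by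
    refine le_iInf₂ fun q hq => ?_
    have : ¬ q.length ≤ θ := fun h => hn ⟨q, hq, h⟩
    exact_mod_cast (by omega : θ + 1 ≤ q.length)
  have h2 : θ + 1 ≤ θ := by exact_mod_cast h1.trans h
  omega

/-- The ends of the edges at `a` that make with the edge `(a, b)` an angle at most `θ`. -/
def angleNeighbors (K : SimpleGraph V) (θ : ℕ) (a b : V) : Set V :=
  {c | K.Adj a c ∧ IsJoinedAvoiding K a θ b c}

/-- Two edges that make a small angle lie on a common short circuit. -/
theorem exists_mem_circuitsThrough {θ : ℕ} {a b c : V} (hab : K.Adj a b)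
    (hc : c ∈ angleNeighbors K θ a b) (hne : c ≠ b) :
    ∃ E ∈ circuitsThrough K (θ + 3) s(a, b), s(a, c) ∈ E := by
  classical
  obtain ⟨hac, q, hq1, hq2⟩ := hc
  have ha : a ∉ q.bypass.support := fun h => hq1 (q.support_bypass_subset_support h)
  have hlen := q.length_bypass_le_length
  refine ⟨_, ⟨a, .cons hab (q.bypass.concat hac.symm), ?_, ?_, ?_, rfl⟩, ?_⟩
  · rw [SimpleGraph.Walk.cons_isCycle_iff]
    refine ⟨q.bypass_isPath.concat ha hac.symm, ?_⟩
    rw [SimpleGraph.Walk.edges_concat, List.concat_eq_append, List.mem_append, not_or]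
    refine ⟨fun h => ha (SimpleGraph.Walk.fst_mem_support_of_mem_edges _ h), fun h => ?_⟩
    rw [List.mem_singleton, Sym2.eq_swap (a := c), Sym2.congr_right] at h
    exact hne h.symm
  · rw [SimpleGraph.Walk.length_cons, SimpleGraph.Walk.length_concat]
    omega
  · simp
  · simp [SimpleGraph.Walk.edges_concat, Sym2.eq_swap]

theorem finite_angleNeighbors (hK : IsFine K) (θ : ℕ) {a b : V} (hab : K.Adj a b) :
    (angleNeighbors K θ a b).Finite := by
  have hfin : (⋃₀ circuitsThrough K (θ + 3) s(a, b)).Finite := by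
    refine (hK (θ + 3) s(a, b) hab).sUnion ?_
    rintro _ ⟨w, c, -, -, -, rfl⟩
    exact List.finite_toSet _
  have hinj : Function.Injective fun c : V => s(a, c) := fun c d h => Sym2.congr_right.1 h
  refine ((hfin.preimage hinj.injOn).union (Set.finite_singleton b)).subset fun c hc => ?_
  by_cases hne : c = b
  · exact Or.inr hne
  · obtain ⟨E, hE, hcE⟩ := exists_mem_circuitsThrough hab hc hne
    exact Or.inl ⟨E, hE, hcE⟩

theorem IsJoinedAvoiding.smul {Γ : Type v} [Group Γ] [MulAction Γ V]
    (hadj : ∀ (γ : Γ) (a b : V), K.Adj a b → K.Adj (γ • a) (γ • b)) (γ : Γ) {u a b : V} {L : ℕ}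
    (h : IsJoinedAvoiding K u L a b) : IsJoinedAvoiding K (γ • u) L (γ • a) (γ • b) := by
  obtain ⟨q, h1, h2⟩ := h
  let f : K →g K := ⟨fun a => γ • a, fun h => hadj γ _ _ h⟩
  refine ⟨q.map f, ?_, by simpa using h2⟩
  rw [SimpleGraph.Walk.support_map, List.mem_map]
  rintro ⟨w, hw, hwu⟩
  exact h1 (MulAction.injective γ hwu ▸ hw)

theorem ncard_angleNeighbors_smul_le {Γ : Type v} [Group Γ] [MulAction Γ V] (hK : IsFine K)
    (hadj : ∀ (γ : Γ) (a b : V), K.Adj a b → K.Adj (γ • a) (γ • b)) (θ : ℕ) (γ : Γ) {a b : V}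
    (hab : K.Adj a b) :
    (angleNeighbors K θ (γ • a) (γ • b)).ncard ≤ (angleNeighbors K θ a b).ncard := by
  have hsub : angleNeighbors K θ (γ • a) (γ • b) ⊆ (fun w => γ • w) '' angleNeighbors K θ a b := by
    rintro c ⟨hc1, hc2⟩
    have h1 := hadj γ⁻¹ _ _ hc1
    have h2 := hc2.smul hadj γ⁻¹
    rw [inv_smul_smul] at h1 h2
    rw [inv_smul_smul] at h2
    exact ⟨γ⁻¹ • c, ⟨h1, h2⟩, smul_inv_smul γ c⟩
  have hfin := finite_angleNeighbors hK θ hab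
  exact (Set.ncard_le_ncard hsub (hfin.image _)).trans (Set.ncard_image_le hfin)

section

variable {Γ : Type v} [Group Γ] [MulAction Γ V] {𝒢 : Set (Subgroup Γ)}

theorem exists_ncard_angleNeighbors_le (hK : IsAssociatedGraph Γ 𝒢 K) (θ : ℕ) :
    ∃ B, ∀ a b : V, K.Adj a b → (angleNeighbors K θ a b).ncard ≤ B := by
  obtain ⟨S, hS, hS'⟩ := hK.finite_edge_orbits
  have h1 : ∀ s : Sym2 V, ∃ B, ∀ a b : V, s = s(a, b) → (angleNeighbors K θ a b).ncard ≤ B := by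
    intro s
    induction s using Sym2.ind with
    | h a b =>
      refine ⟨max (angleNeighbors K θ a b).ncard (angleNeighbors K θ b a).ncard, ?_⟩
      intro c d h
      rcases Sym2.eq_iff.1 h with ⟨rfl, rfl⟩ | ⟨rfl, rfl⟩
      · exact le_max_left _ _
      · exact le_max_right _ _
  choose β hβ using h1
  refine ⟨hS.toFinset.sup β, fun a b hab => ?_⟩
  obtain ⟨s, hs, γ, hγ⟩ := hS' s(a, b) hab
  obtain ⟨a', b', rfl, rfl, rfl⟩ : ∃ a' b', s = s(a', b') ∧ a = γ • a' ∧ b = γ • b' := by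
    induction s using Sym2.ind with
    | h c d =>
      rw [Sym2.map_mk] at hγ
      rcases Sym2.eq_iff.1 hγ with ⟨h, h'⟩ | ⟨h, h'⟩
      · exact ⟨c, d, rfl, h.symm, h'.symm⟩
      · exact ⟨d, c, Sym2.eq_swap, h'.symm, h.symm⟩
  have hab' : K.Adj a' b' := by
    have := hK.adj_smul γ⁻¹ _ _ hab
    rwa [inv_smul_smul, inv_smul_smul] at this
  exact (ncard_angleNeighbors_smul_le hK.fine hK.adj_smul θ γ hab').trans
    ((hβ _ a' b' rfl).trans (Finset.le_sup (f := β) (hS.mem_toFinset.2 hs)))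

/-- The ends of the paths of length `k` issued from `a`, whose angles, including the angle at `a`
with the edge `(a, b)`, are at most `θ`. -/
def fan (K : SimpleGraph V) (θ : ℕ) : ℕ → V → V → Set V
  | 0, a, _ => {a}
  | k + 1, a, b => ⋃ c ∈ angleNeighbors K θ a b, fan K θ k c a

theorem mem_fan {θ : ℕ} (k : ℕ) : ∀ {p : ℕ → V} {b : V}, IsVertexPath K p k →
    (0 < k → IsJoinedAvoiding K (p 0) θ b (p 1)) →
    (∀ i, 0 < i → i < k → IsJoinedAvoiding K (p i) θ (p (i - 1)) (p (i + 1))) →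
    p k ∈ fan K θ k (p 0) b := by
  induction k with
  | zero => intro p b _ _ _; exact rfl
  | succ k ih =>
    intro p b hp h0 h
    have hp' := hp.shift 1
    refine Set.mem_biUnion (x := p 1) ⟨hp 0 (by omega), h0 (by omega)⟩ ?_
    have := ih (p := fun t => p (1 + t)) (b := p 0) hp' (fun hk => h 1 (by omega) (by omega))
      (fun i hi hik => by
        have := h (1 + i) (by omega) (by omega)
        rwa [show 1 + i - 1 = 1 + (i - 1) by omega] at this)
    rwa [add_comm k 1]

theorem exists_finset_fan_subset {θ B : ℕ} (hfin : ∀ a b, K.Adj a b →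
    (angleNeighbors K θ a b).Finite) (hB : ∀ a b, K.Adj a b → (angleNeighbors K θ a b).ncard ≤ B)
    (k : ℕ) : ∀ {a b : V}, K.Adj a b → ∃ F : Finset V, fan K θ k a b ⊆ F ∧ F.card ≤ B ^ k := by
  classical
  induction k with
  | zero => intro a b _; exact ⟨{a}, by simp [fan], by simp⟩
  | succ k ih =>
    intro a b hab
    have h : ∀ c, ∃ F : Finset V, c ∈ angleNeighbors K θ a b →
        fan K θ k c a ⊆ F ∧ F.card ≤ B ^ k := by
      intro c
      by_cases hc : c ∈ angleNeighbors K θ a b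
      · obtain ⟨F, hF⟩ := ih hc.1.symm
        exact ⟨F, fun _ => hF⟩
      · exact ⟨∅, fun h => absurd h hc⟩
    choose F hF using h
    refine ⟨(hfin a b hab).toFinset.biUnion F, ?_, ?_⟩
    · intro w hw
      obtain ⟨c, hc, hw⟩ := Set.mem_iUnion₂.1 hw
      rw [Finset.mem_coe, Finset.mem_biUnion]
      exact ⟨c, (hfin a b hab).mem_toFinset.2 hc, (hF c hc).1 hw⟩
    · refine (Finset.card_biUnion_le_card_mul _ _ (B ^ k) fun c hc =>
        (hF c ((hfin a b hab).mem_toFinset.1 hc)).2).trans ?_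
      rw [← Set.ncard_eq_toFinset_card _ (hfin a b hab), pow_succ, mul_comm]
      exact Nat.mul_le_mul_left _ (hB a b hab)

theorem cone_subset_fan (r θ : ℕ) (a b : V) :
    cone K r θ a b ⊆ ⋃ k ∈ Finset.range (r + 1), fan K θ k a b := by
  rintro w ⟨h1, g, hg, h2, h3⟩
  have hg' : g.length = K.dist a w := hg
  refine Set.mem_biUnion (x := g.length) (by simp; omega) ?_
  have := mem_fan (θ := θ) g.length (b := b) (isVertexPath_getVert g)
    (fun h => by rw [g.getVert_zero]; exact isJoinedAvoiding_of_angleAt_le (h3 h))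
    (fun i hi hi' => isJoinedAvoiding_of_angleAt_le ((le_iSup₂ (f := fun (i : ℕ)
      (_ : 0 < i ∧ i < g.length) => angleAt K (g.getVert i) (g.getVert (i - 1))
        (g.getVert (i + 1))) i ⟨hi, hi'⟩).trans h2))
  rwa [g.getVert_zero, g.getVert_length] at this

/-- In a graph associated to a relatively hyperbolic group, cones are uniformly finite. -/
theorem exists_cone_bound (hK : IsAssociatedGraph Γ 𝒢 K) (r θ : ℕ) :
    ∃ B, ∀ a b : V, K.Adj a b → ∃ F : Finset V, cone K r θ a b ⊆ F ∧ F.card ≤ B := by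
  classical
  obtain ⟨B, hB⟩ := exists_ncard_angleNeighbors_le hK θ
  refine ⟨∑ k ∈ Finset.range (r + 1), B ^ k, fun a b hab => ?_⟩
  choose F hF using fun k => exists_finset_fan_subset
    (fun a b h => finite_angleNeighbors hK.fine θ h) hB k hab
  refine ⟨(Finset.range (r + 1)).biUnion F, fun w hw => ?_,
    Finset.card_biUnion_le.trans (Finset.sum_le_sum fun k _ => (hF k).2)⟩
  obtain ⟨k, hk, hw⟩ := Set.mem_iUnion₂.1 (cone_subset_fan r θ a b hw)
  rw [Finset.mem_coe, Finset.mem_biUnion]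
  exact ⟨k, hk, (hF k).1 hw⟩

/-- The union of the cones centered at the edges `(g i, g (i + 1))`, with `i` in `I`, of a
path. -/
def conesAlong (K : SimpleGraph V) (r : ℕ) (g : ℕ → V) (I : Finset ℕ) : Set V :=
  {w | ∃ i ∈ I, w ∈ cone K r r (g i) (g (i + 1)) ∨ w ∈ cone K r r (g (i + 1)) (g i)}

theorem exists_finset_conesAlong_subset {r B : ℕ} (hB : ∀ a b : V, K.Adj a b →
    ∃ F : Finset V, cone K r r a b ⊆ F ∧ F.card ≤ B) {g : ℕ → V} {n : ℕ} (hg : IsVertexPath K g n)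
    {I : Finset ℕ} (hI : ∀ i ∈ I, i < n) :
    ∃ F : Finset V, conesAlong K r g I ⊆ F ∧ F.card ≤ I.card * (2 * B) := by
  classical
  have h : ∀ i, ∃ F : Finset V, i ∈ I →
      (cone K r r (g i) (g (i + 1)) ⊆ F ∧ cone K r r (g (i + 1)) (g i) ⊆ F) ∧
        F.card ≤ 2 * B := by
    intro i
    by_cases hi : i ∈ I
    · obtain ⟨F, h1, h2⟩ := hB _ _ (hg i (hI i hi))
      obtain ⟨F', h1', h2'⟩ := hB _ _ (hg i (hI i hi)).symm
      refine ⟨F ∪ F', fun _ => ⟨⟨?_, ?_⟩, (Finset.card_union_le _ _).trans (by omega)⟩⟩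
      · rw [Finset.coe_union]; exact h1.trans Set.subset_union_left
      · rw [Finset.coe_union]; exact h1'.trans Set.subset_union_right
    · exact ⟨∅, fun h => absurd h hi⟩
  choose F hF using h
  refine ⟨I.biUnion F, ?_, Finset.card_biUnion_le_card_mul _ _ _ fun i hi => (hF i hi).2⟩
  rintro w ⟨i, hi, hw⟩
  rw [Finset.mem_coe, Finset.mem_biUnion]
  exact ⟨i, hi, hw.elim (fun h => (hF i hi).1.1 h) fun h => (hF i hi).1.2 h⟩

theorem conicalNeighborhood_subset_conesAlong {r : ℕ} {x y : V} (g : K.Walk x y) :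
    conicalNeighborhood r g ⊆ conesAlong K r g.getVert (Finset.range g.length) := by
  rintro w ⟨a, b, hab, hw⟩
  obtain ⟨i, hi, hi'⟩ := g.toSubgraph_adj_iff.1
    (SimpleGraph.Walk.adj_toSubgraph_iff_mem_edges.2 hab)
  refine ⟨i, Finset.mem_range.2 hi', ?_⟩
  rcases Sym2.eq_iff.1 hi with ⟨h1, h2⟩ | ⟨h1, h2⟩
  · rw [h1, h2]; exact Or.inl hw
  · rw [h1, h2]; exact Or.inr hw

/-- Encoding the vertices of `F` in a finite type that depends only on `B` makes the resulting
counts uniform in `F`. -/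
theorem exists_code {F : Finset V} {B : ℕ} (hF : F.card ≤ B) :
    ∃ code : V → Fin (B + 1), Set.InjOn code F := by
  classical
  refine ⟨fun w => if h : w ∈ F then Fin.castLE (by omega) (F.equivFin ⟨w, h⟩) else Fin.last B, ?_⟩
  intro a ha b hb hab
  rw [Finset.mem_coe] at ha hb
  simp only [ha, hb, dif_pos] at hab
  have := F.equivFin.injective (Fin.castLE_injective _ hab)
  exact congrArg Subtype.val this

theorem map_injOn {α : Type*} {f : V → α} {s : Set V} (hf : Set.InjOn f s) :
    Set.InjOn (List.map f) {l | ∀ w ∈ l, w ∈ s} := by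
  intro l
  induction l with
  | nil => intro _ l' _ h; simpa [eq_comm] using h
  | cons a l ih =>
    intro hl l' hl' h
    cases l' with
    | nil => simp at h
    | cons b l' =>
      simp only [List.map_cons, List.cons.injEq] at h
      simp only [Set.mem_ofPred_eq, List.forall_mem_cons] at hl hl'
      rw [hf hl.1 hl'.1 h.1, ih hl.2 hl'.2 h.2]

/-- The number of lists without repetition in a set of `B + 1` elements. -/
noncomputable def nodupListCount (B : ℕ) : ℕ :=
  Nat.card {l : List (Fin (B + 1)) // l.Nodup}

theorem encard_nodup_lists_le {F : Finset V} {B : ℕ} (hF : F.card ≤ B) :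
    {l : List V | l.Nodup ∧ ∀ w ∈ l, w ∈ F}.encard ≤ (nodupListCount B : ℕ∞) := by
  obtain ⟨code, hcode⟩ := exists_code hF
  have h := Set.encard_le_encard_of_injOn (f := List.map code)
    (s := {l : List V | l.Nodup ∧ ∀ w ∈ l, w ∈ F}) (t := {l : List (Fin (B + 1)) | l.Nodup})
    (fun l hl => List.Nodup.map_on (fun a ha b hb h => hcode (hl.2 a ha) (hl.2 b hb) h) hl.1)
    ((map_injOn hcode).mono fun l hl => hl.2)
  refine h.trans (le_of_eq ?_)
  have hfin : {l : List (Fin (B + 1)) | l.Nodup}.Finite :=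
    Set.finite_coe_iff.1 (inferInstanceAs (Finite {l : List (Fin (B + 1)) // l.Nodup}))
  rw [← hfin.cast_ncard_eq]
  rfl

theorem isCapacityBound_of_cone_bound {ε B : ℕ}
    (hB : ∀ a b : V, K.Adj a b → ∃ F : Finset V, cone K ε ε a b ⊆ F ∧ F.card ≤ B) {Capa : ℕ → ℕ}
    (hCapa : ∀ L, nodupListCount (L * (2 * B)) ≤ Capa L) : IsCapacityBound K ε Capa := by
  intro x y g hg
  obtain ⟨F, hF, hF'⟩ := exists_finset_conesAlong_subset hB (isVertexPath_getVert g)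
    (I := Finset.range g.length) (fun i hi => Finset.mem_range.1 hi)
  rw [Finset.card_range] at hF'
  refine (Set.encard_le_encard (t := {l : List V | l.Nodup ∧ ∀ w ∈ l, w ∈ F}) ?_).trans
    ((encard_nodup_lists_le hF').trans (by exact_mod_cast hCapa _))
  rintro _ ⟨a, b, q, hq, -, hq', rfl⟩
  exact ⟨(q.isPath_of_length_eq_dist hq).support_nodup,
    fun w hw => hF (conicalNeighborhood_subset_conesAlong g (hq' w hw))⟩

end

/-! ### Local quasi-geodesics -/

/-- `L`-local-`Λ`-quasi-geodesics, for an integer `Λ`. -/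
def IsLocalQuasiGeo (K : SimpleGraph V) (L Λ : ℕ) (f : ℕ → V) (n : ℕ) : Prop :=
  ∀ i j, i ≤ j → j ≤ n → j ≤ i + L → j ≤ i + Λ * K.dist (f i) (f j)

/-- The first `n + 1` terms of `f` are `E`-close to the geodesic `g` from `x` to `y`. -/
def IsCloseTo (K : SimpleGraph V) (E : ℕ) (x y : V) (g f : ℕ → V) (n : ℕ) : Prop :=
  ∀ t ≤ n, ∃ i ≤ K.dist x y, K.dist (f t) (g i) ≤ E

/-- A local quasi-geodesic that is close to a geodesic moves away from its origin: it cannot turn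
back, as this would have to happen on a short subpath. -/
theorem IsLocalQuasiGeo.progress {L Λ E n : ℕ} (hΛ : 0 < Λ) {x y : V} {f g : ℕ → V}
    (hK : K.Connected) (hf : IsVertexPath K f n) (h0 : f 0 = x) (hloc : IsLocalQuasiGeo K L Λ f n)
    (hg : IsGeodesicFromTo K g x y) (hclose : IsCloseTo K E x y g f n) {a : ℕ}
    (ha : Λ * (4 * E + 3) ≤ a) (haL : a ≤ L) (t : ℕ) (ht : t + a ≤ n) :
    a + Λ * K.dist x (f t) ≤ Λ * (K.dist x (f (t + a)) + 4 * E) := by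
  have hbig : ∀ t, t + a ≤ n → a ≤ Λ * K.dist (f t) (f (t + a)) ∧
      4 * E + 3 ≤ K.dist (f t) (f (t + a)) := by
    intro t ht
    have := hloc t (t + a) (by omega) ht (by omega)
    exact ⟨by omega, Nat.le_of_mul_le_mul_left (by omega) hΛ⟩
  have hle : ∀ t, t + a ≤ n → K.dist x (f t) ≤ K.dist x (f (t + a)) := by
    intro t
    induction t with
    | zero => intro _; rw [h0]; simp
    | succ t ih =>
      intro ht
      have h1 := ih (by omega)
      obtain ⟨i, hi, hi'⟩ := hclose t (by omega)
      obtain ⟨j, hj, hj'⟩ := hclose (t + a) (by omega)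
      have h2 := hg.dist_le_of_close hK hi hj hi' hj' h1
      have h3 := (hbig t (by omega)).2
      have h4 := hf.dist_succ_le hK x (t := t) (by omega)
      have h5 := SimpleGraph.dist_eq_one_iff_adj.2 (hf (t + a) (by omega))
      have h6 := hK.dist_triangle (u := x) (v := f (t + a + 1)) (w := f (t + a))
      rw [SimpleGraph.dist_comm (u := f (t + a + 1))] at h6
      rw [show t + 1 + a = t + a + 1 by omega]
      omega
  obtain ⟨i, hi, hi'⟩ := hclose t (by omega)
  obtain ⟨j, hj, hj'⟩ := hclose (t + a) ht
  have h2 := hg.dist_le_of_close hK hi hj hi' hj' (hle t ht)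
  have h3 := (hbig t ht).1
  have h4 := Nat.mul_le_mul_left Λ h2
  rw [Nat.mul_add] at h4
  omega

/-- Local quasi-geodesics that are close to a geodesic are quasi-geodesics. -/
theorem IsLocalQuasiGeo.isQuasiGeo {L Λ E n : ℕ} (hΛ : 0 < Λ) {x y : V} {f g : ℕ → V}
    (hK : K.Connected) (hf : IsVertexPath K f n) (h0 : f 0 = x) (hloc : IsLocalQuasiGeo K L Λ f n)
    (hg : IsGeodesicFromTo K g x y) (hclose : IsCloseTo K E x y g f n)
    (hL : 2 * (Λ * (8 * E + 3)) ≤ L) : IsQuasiGeo K (2 * Λ) f n := by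
  obtain ⟨a, ha⟩ : ∃ a, a = Λ * (8 * E + 3) := ⟨_, rfl⟩
  have hb : Λ * (4 * E + 3) ≤ a := ha ▸ Nat.mul_le_mul_left _ (by omega)
  have hapos : 0 < a := ha ▸ Nat.mul_pos hΛ (by omega)
  have e1 : Λ * (8 * E + 3) = 2 * (Λ * (4 * E)) + Λ * 3 := by ring
  have key : ∀ T, a ≤ T → ∀ t, t + T ≤ n →
      T + 2 * Λ * K.dist x (f t) ≤ 2 * Λ * K.dist x (f (t + T)) := by
    intro T
    induction T using Nat.strong_induction_on with
    | _ T ih =>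
      intro haT t ht
      rcases le_or_gt T L with h | h
      · have := hloc.progress hΛ hK hf h0 hg hclose (hb.trans haT) h t ht
        rw [Nat.mul_add] at this
        rw [mul_assoc, mul_assoc]
        omega
      · have h1 := ih (T - a) (by omega) (by omega) t (by omega)
        have h2 := ih a (by omega) le_rfl (t + (T - a)) (by omega)
        rw [show t + (T - a) + a = t + T by omega] at h2
        omega
  intro i j hij hj
  rcases le_or_gt j (i + L) with h | h
  · have := hloc i j hij hj h
    rw [mul_assoc]
    omega
  · have h1 := key (j - i) (by omega) i (by omega)
    rw [Nat.add_sub_cancel' hij] at h1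
    have h2 := Nat.mul_le_mul_left (2 * Λ) (hK.dist_triangle (u := x) (v := f i) (w := f j))
    rw [Nat.mul_add] at h2
    omega

/-- A quasi-geodesic that is close to a geodesic with the same origin moves away from this origin,
up to a bounded error. -/
theorem IsQuasiGeo.dist_lt {Λ D n : ℕ} {x y : V} {f g : ℕ → V} (hK : K.Connected)
    (hf : IsVertexPath K f n) (h0 : f 0 = x) (hq : IsQuasiGeo K Λ f n)
    (hg : IsGeodesicFromTo K g x y) (hclose : IsCloseTo K D x y g f n) {s t : ℕ}
    (hst : s + Λ * (4 * D) < t) (ht : t ≤ n) : K.dist x (f s) < K.dist x (f t) := by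
  by_contra! h
  obtain ⟨r, hr, hr'⟩ := exists_eq_of_lipschitz (u := fun r => K.dist x (f r)) (n := s)
    (a := K.dist x (f t)) (by rw [h0]; simp) h
    (fun r hr => hf.dist_succ_le hK x (by omega))
  obtain ⟨i, hi, hi'⟩ := hclose r (by omega)
  obtain ⟨j, hj, hj'⟩ := hclose t ht
  have h1 := hg.dist_le_of_close hK hi hj hi' hj' hr'.le
  have h2 := hq r t (by omega) ht
  have h3 := Nat.mul_le_mul_left Λ (show K.dist (f r) (f t) ≤ 4 * D by
    have : K.dist x (f r) = K.dist x (f t) := hr'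
    omega)
  omega

theorem IsQuasiGeo.dist_le_add {Λ D n : ℕ} {x y : V} {f g : ℕ → V} (hK : K.Connected)
    (hf : IsVertexPath K f n) (h0 : f 0 = x) (hq : IsQuasiGeo K Λ f n)
    (hg : IsGeodesicFromTo K g x y) (hclose : IsCloseTo K D x y g f n) {s t : ℕ}
    (hst : s ≤ t) (ht : t ≤ n) : K.dist x (f s) ≤ K.dist x (f t) + Λ * (4 * D) := by
  rcases le_or_gt t (s + Λ * (4 * D)) with h | h
  · have h1 := hf.dist_le hK hst ht
    have h2 := hK.dist_triangle (u := x) (v := f t) (w := f s)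
    rw [SimpleGraph.dist_comm (u := f t)] at h2
    omega
  · have := hq.dist_lt hK hf h0 hg hclose h ht
    omega

/-! ### Coarse piecewise geodesics -/

/-- The intervals `[c i, d i]`, for `i ≤ k`, are successive sections of `f`: on each of them `f` is
an `M`-local geodesic, and they are separated by bridges of length at most `ε`. Their lengths are
not restricted. -/
structure IsSectioned (K : SimpleGraph V) (ε M : ℕ) (f : ℕ → V) (c d : ℕ → ℕ) (k : ℕ) : Prop where
  start : c 0 = 0
  c_le_d : ∀ i ≤ k, c i ≤ d i
  d_le_c : ∀ i < k, d i ≤ c (i + 1)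
  bridge : ∀ i < k, c (i + 1) ≤ d i + ε
  local_geodesic : ∀ i ≤ k, ∀ s t, c i ≤ s → s ≤ t → t ≤ d i → t ≤ s + M →
    K.dist (f s) (f t) = t - s

/-- The sections, other than the first and the last one, have length at least `l`. -/
def HasLongSections (l : ℕ) (c d : ℕ → ℕ) (k : ℕ) : Prop :=
  ∀ i, 0 < i → i < k → c i + l ≤ d i

theorem IsSectioned.mono {ε M : ℕ} {f : ℕ → V} {c d : ℕ → ℕ} {k k' : ℕ}
    (h : IsSectioned K ε M f c d k) (hk : k' ≤ k) : IsSectioned K ε M f c d k' :=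
  ⟨h.start, fun i hi => h.c_le_d i (by omega), fun i hi => h.d_le_c i (by omega),
    fun i hi => h.bridge i (by omega), fun i hi => h.local_geodesic i (by omega)⟩

theorem IsSectioned.d_le_d {ε M : ℕ} {f : ℕ → V} {c d : ℕ → ℕ} {k i j : ℕ}
    (h : IsSectioned K ε M f c d k) (hij : i ≤ j) (hj : j ≤ k) : d i ≤ d j := by
  induction j, hij using Nat.le_induction with
  | base => exact le_rfl
  | succ j hij ih =>
    have h1 := ih (by omega)
    have h2 := h.d_le_c j (by omega)
    have h3 := h.c_le_d (j + 1) hj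
    omega

theorem IsSectioned.d_le_c_of_lt {ε M : ℕ} {f : ℕ → V} {c d : ℕ → ℕ} {k i j : ℕ}
    (h : IsSectioned K ε M f c d k) (hij : i < j) (hj : j ≤ k) : d i ≤ c j := by
  obtain ⟨j, rfl⟩ : ∃ j', j = j' + 1 := ⟨j - 1, by omega⟩
  have h1 := h.d_le_d (i := i) (j := j) (by omega) (by omega)
  have h2 := h.d_le_c j (by omega)
  omega

/-- The scale at which coarse piecewise geodesics are quasi-geodesics. -/
def localScale (δ ε : ℕ) : ℕ := 40 * lam δ * (ε + 100 * lam δ * δ)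

/-- Coarse piecewise geodesics, as sequences of vertices with sections indexed by integers. -/
structure IsCoarsePath (K : SimpleGraph V) (δ ε l : ℕ) (x y : V) (f : ℕ → V) (n : ℕ)
    (c d : ℕ → ℕ) (m : ℕ) : Prop where
  path : IsVertexPath K f n
  source : f 0 = x
  target : f n = y
  sectioned : IsSectioned K ε (mu δ ε) f c d m
  finish : d m = n
  long : HasLongSections l c d m
  localQuasi : IsLocalQuasiGeo K (localScale δ ε) (500 * δ) f n
  near : ∃ g, IsGeodesicFromTo K g x y ∧ IsCloseTo K (2 * ε) x y g f n

/-- The vertex `f t` of the section `[c k, d k]` is far from the ends of this section, unless these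
are the ends `x` and `y` of the path. -/
structure IsDeepIn (K : SimpleGraph V) (l : ℕ) (x y : V) (f : ℕ → V) (c d : ℕ → ℕ) (k t : ℕ) :
    Prop where
  c_le : c k ≤ t
  le_d : t ≤ d k
  far_c : f (c k) ≠ x → l ≤ K.dist (f (c k)) (f t)
  far_d : f (d k) ≠ y → l ≤ K.dist (f (d k)) (f t)

theorem lam_div_two (δ : ℕ) : (lam δ : ℝ) / 2 = ((500 * δ : ℕ) : ℝ) := by
  unfold lam
  push_cast
  ring

theorem IsCoarsePath.mem_cylinder {δ ε l : ℕ} (hδ : 0 < δ) (hK : K.Connected) {x y : V}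
    {f : ℕ → V} {n : ℕ} {c d : ℕ → ℕ} {m : ℕ} (h : IsCoarsePath K δ ε l x y f n c d m) {k t : ℕ}
    (hk : k ≤ m) (ht : IsDeepIn K l x y f c d k t) : f t ∈ cylinder K δ ε l x y := by
  obtain ⟨q, hq, hq'⟩ := h.path.exists_walk
  obtain ⟨q, hq, hq'⟩ : ∃ q : K.Walk x y, q.length = n ∧ ∀ t ≤ n, q.getVert t = f t :=
    ⟨q.copy h.source h.target, by simpa using hq, fun t ht => by simpa using hq' t ht⟩
  have hd : ∀ i ≤ m, d i ≤ n := fun i hi => h.finish ▸ h.sectioned.d_le_d hi le_rfl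
  have hc : ∀ i ≤ m, c i ≤ n := fun i hi => (h.sectioned.c_le_d i hi).trans (hd i hi)
  refine ⟨q, m, fun i => c i, fun i => d i, ?_, ⟨k, by omega⟩, t, ht.c_le, ht.le_d,
    hq' t (ht.le_d.trans (hd k hk)), ?_, ?_⟩
  · refine ⟨h.sectioned.start, h.finish.trans hq.symm,
      fun i => h.sectioned.c_le_d i (by omega), fun i => h.sectioned.d_le_c i i.2, ?_, ?_, ?_, ?_, ?_⟩
    · intro s t hst ht htL i j hi hij hj
      rw [lam_div_two, hq' i (by omega), hq' j (by omega)]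
      have hδ' : (0 : ℝ) < ((500 * δ : ℕ) : ℝ) := by exact_mod_cast (by omega : 0 < 500 * δ)
      constructor
      · rw [div_le_iff₀ hδ']
        have h1 := h.localQuasi i j hij (by omega) (by unfold localScale; omega)
        have h2 : (j : ℝ) ≤ i + ((500 * δ : ℕ) : ℝ) * K.dist (f i) (f j) := by exact_mod_cast h1
        linarith
      · have h1 := h.path.dist_le hK hij (by omega)
        have h2 : K.dist (f i) (f j) + 500 * δ * i ≤ 500 * δ * j := by
          obtain ⟨r, rfl⟩ := Nat.exists_eq_add_of_le hij
          have h3 : r ≤ 500 * δ * r := Nat.le_mul_of_pos_left _ (by omega)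
          rw [Nat.mul_add]
          omega
        have h3 : (K.dist (f i) (f j) : ℝ) + ((500 * δ : ℕ) : ℝ) * i ≤ ((500 * δ : ℕ) : ℝ) * j := by
          exact_mod_cast h2
        linarith
    · intro i s t hs hst ht htM
      have := hd i (by omega)
      rw [hq' s (by omega), hq' t (by omega)]
      exact h.sectioned.local_geodesic i (by omega) s t hs hst ht (by omega)
    · intro i hi0 him
      have h1 := h.long i (Nat.pos_of_ne_zero fun h => hi0 (Fin.ext h))
        (by have := i.2; have : (i : ℕ) ≠ m := fun h => him (Fin.ext h); omega)
      omega
    · intro i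
      have := h.sectioned.bridge i i.2
      simp only [Fin.val_succ, Fin.val_castSucc]
      omega
    · obtain ⟨g, hg, hg'⟩ := h.near
      obtain ⟨w, hw, hw'⟩ := hg.exists_walk
      refine ⟨w, hw, fun v hv => ?_⟩
      obtain ⟨t, rfl, ht⟩ := SimpleGraph.Walk.mem_support_iff_exists_getVert.1 hv
      obtain ⟨i, hi, hi'⟩ := hg' t (by omega)
      refine ⟨w.getVert i, w.getVert_mem_support i, ?_⟩
      rwa [hq' t (by omega), hw' i hi]
  · dsimp only
    rw [hq' _ (hc k hk)]
    exact ht.far_c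
  · dsimp only
    rw [hq' _ (hd k hk)]
    exact ht.far_d

theorem exists_isCoarsePath_of_mem_cylinder {δ ε l : ℕ} (hδ : 0 < δ) (hK : K.Connected) {x y w : V}
    (hw : w ∈ cylinder K δ ε l x y) :
    ∃ (f : ℕ → V) (n : ℕ) (c d : ℕ → ℕ) (m k t : ℕ), IsCoarsePath K δ ε l x y f n c d m ∧
      k ≤ m ∧ IsDeepIn K l x y f c d k t ∧ f t = w := by
  obtain ⟨q, m, c, d, h, k, t, h1, h2, h3, h4, h5⟩ := hw
  have hof : ∀ (e : Fin (m + 1) → ℕ) (i : ℕ) (hi : i < m + 1), e (Fin.ofNat (m + 1) i) = e ⟨i, hi⟩ :=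
    fun e i hi => congrArg e (Fin.ext (Nat.mod_eq_of_lt hi))
  have hk : ∀ e : Fin (m + 1) → ℕ, e (Fin.ofNat (m + 1) k) = e k := fun e => hof e k k.2
  refine ⟨q.getVert, q.length, fun i => c (Fin.ofNat (m + 1) i), fun i => d (Fin.ofNat (m + 1) i),
    m, k, t, ⟨isVertexPath_getVert q, by simp, by simp, ⟨h.start, ?_, ?_, ?_, ?_⟩, ?_, ?_, ?_, ?_⟩,
    by omega, ⟨?_, ?_, ?_, ?_⟩, h3⟩
  · exact fun i _ => h.c_le_d _
  · intro i hi
    rw [hof d i (by omega), hof c (i + 1) (by omega)]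
    exact h.d_le_c ⟨i, hi⟩
  · intro i hi
    rw [hof d i (by omega), hof c (i + 1) (by omega)]
    have := h.bridge ⟨i, hi⟩
    simp only [Fin.succ_mk, Fin.castSucc_mk] at this
    omega
  · intro i _ s t hs hst ht htM
    exact h.local_geodesic _ s t hs hst ht (by omega)
  · rw [hof d m (by omega)]
    exact h.finish
  · intro i hi0 him
    dsimp only
    rw [hof d i (by omega), hof c i (by omega)]
    have h6 := h.long ⟨i, by omega⟩ (fun h => by simp [Fin.ext_iff] at h; omega)
      (fun h => by simp [Fin.ext_iff] at h; omega)
    have h7 := h.c_le_d ⟨i, by omega⟩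
    rcases Nat.eq_zero_or_pos l with h0 | h0 <;> omega
  · intro i j hij hj hjL
    have h6 := (h.local_quasi i j hij hj (by unfold localScale at hjL; omega) i j le_rfl hij le_rfl).1
    rw [lam_div_two, div_le_iff₀ (by exact_mod_cast (by omega : 0 < 500 * δ))] at h6
    have : (j : ℝ) ≤ ((i + 500 * δ * K.dist (q.getVert i) (q.getVert j) : ℕ) : ℝ) := by
      push_cast at h6 ⊢
      linarith
    exact_mod_cast this
  · obtain ⟨g, hg, hg'⟩ := h.near
    refine ⟨g.getVert, isGeodesicFromTo_getVert hK hg, fun t _ => ?_⟩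
    obtain ⟨w', hw', hd⟩ := hg' _ (q.getVert_mem_support t)
    obtain ⟨i, rfl, hi⟩ := SimpleGraph.Walk.mem_support_iff_exists_getVert.1 hw'
    exact ⟨i, hi.trans (le_of_eq hg), hd⟩
  · rw [hk c]; exact h1
  · rw [hk d]; exact h2
  · rw [hk c, h3]; exact h4
  · rw [hk d, h3]; exact h5

/-! ### Redirecting a coarse piecewise geodesic -/

/-- The sequence that follows `f` up to the instant `a`, and from then on follows `f'`, from its
instant `b`. -/
def splice (f f' : ℕ → V) (a b : ℕ) : ℕ → V :=
  fun r => if r ≤ a then f r else f' (r - a + b)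

theorem splice_of_le {f f' : ℕ → V} {a b r : ℕ} (h : r ≤ a) : splice f f' a b r = f r :=
  if_pos h

theorem splice_of_ge {f f' : ℕ → V} {a b r : ℕ} (hab : f a = f' b) (h : a ≤ r) :
    splice f f' a b r = f' (r - a + b) := by
  rcases h.eq_or_lt with rfl | h
  · rw [splice_of_le le_rfl, hab, Nat.sub_self, Nat.zero_add]
  · exact if_neg (by omega)

theorem IsVertexPath.splice {f f' : ℕ → V} {a b n n' : ℕ} (hf : IsVertexPath K f n)
    (hf' : IsVertexPath K f' n') (hab : f a = f' b) (ha : a ≤ n) (hb : b ≤ n') :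
    IsVertexPath K (splice f f' a b) (a + (n' - b)) := by
  intro r hr
  rcases lt_or_ge r a with h | h
  · rw [splice_of_le h.le, splice_of_le h]
    exact hf r (by omega)
  · rw [splice_of_ge hab h, splice_of_ge hab (by omega), show r + 1 - a + b = r - a + b + 1 by omega]
    exact hf' _ (by omega)

/-- The properties of a coarse piecewise geodesic that do not involve its sections: a local
quasi-geodesic, thus a quasi-geodesic, that is `D`-close to the geodesic `g`. -/
structure IsTrack (K : SimpleGraph V) (δ ε D : ℕ) (x y : V) (g f : ℕ → V) (n : ℕ) : Prop where
  geodesic : IsGeodesicFromTo K g x y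
  path : IsVertexPath K f n
  source : f 0 = x
  target : f n = y
  localQuasi : IsLocalQuasiGeo K (localScale δ ε) (500 * δ) f n
  quasi : IsQuasiGeo K (1000 * δ) f n
  close : IsCloseTo K D x y g f n

/-- A bound for the backward progress of the tracks. -/
def driftBound (δ D : ℕ) : ℕ := 1000 * δ * (4 * D)

theorem IsTrack.dist_lt {δ ε D : ℕ} {x y : V} {g f : ℕ → V} {n : ℕ} (hK : K.Connected)
    (h : IsTrack K δ ε D x y g f n) {s t : ℕ} (hst : s + driftBound δ D < t) (ht : t ≤ n) :
    K.dist x (f s) < K.dist x (f t) :=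
  h.quasi.dist_lt hK h.path h.source h.geodesic h.close hst ht

theorem IsTrack.dist_le_add {δ ε D : ℕ} {x y : V} {g f : ℕ → V} {n : ℕ} (hK : K.Connected)
    (h : IsTrack K δ ε D x y g f n) {s t : ℕ} (hst : s ≤ t) (ht : t ≤ n) :
    K.dist x (f s) ≤ K.dist x (f t) + driftBound δ D :=
  h.quasi.dist_le_add hK h.path h.source h.geodesic h.close hst ht

theorem IsVertexPath.dist_source_le {f : ℕ → V} {n : ℕ} (hK : K.Connected)
    (h : IsVertexPath K f n) (x : V) {s t : ℕ} (hst : s ≤ t) (ht : t ≤ n) :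
    K.dist x (f t) ≤ K.dist x (f s) + (t - s) := by
  have h1 := h.dist_le hK hst ht
  have h2 := hK.dist_triangle (u := x) (v := f s) (w := f t)
  omega

/-- The geodesics `g` from `x` to `y` and `h` from `x` to `z` are `δ`-close up to the distance `G`
from `x`. -/
structure IsFork (K : SimpleGraph V) (δ G : ℕ) (x y z : V) (g h : ℕ → V) : Prop where
  left : IsGeodesicFromTo K g x y
  right : IsGeodesicFromTo K h x z
  le_left : G ≤ K.dist x y
  le_right : G ≤ K.dist x z
  dist_le : ∀ i ≤ G, K.dist (g i) (h i) ≤ δ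

theorem isFork_of_le_gromovProduct {δ G : ℕ} {x y z : V} {g h : ℕ → V}
    (hK : IsHyperbolicGraph δ K) (hg : IsGeodesicFromTo K g x y) (hh : IsGeodesicFromTo K h x z)
    (hG : (G : ℝ) ≤ gromovProduct K x y z) : IsFork K δ G x y z g h := by
  have hG' : 2 * G + K.dist y z ≤ K.dist x y + K.dist x z := by
    unfold gromovProduct at hG
    exact_mod_cast (by linarith : (2 * G + K.dist y z : ℝ) ≤ K.dist x y + K.dist x z)
  have t1 := hK.1.dist_triangle (u := x) (v := y) (w := z)
  have t2 := hK.1.dist_triangle (u := x) (v := z) (w := y)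
  rw [SimpleGraph.dist_comm (u := z)] at t2
  have hy : G ≤ K.dist x y := by omega
  have hz : G ≤ K.dist x z := by omega
  refine ⟨hg, hh, hy, hz, fun i hi => hK.2 x y z _ _ ?_ ?_ ?_ ?_⟩
  · rw [hg.dist_source (by omega), hg.dist_target (by omega)]; omega
  · rw [hh.dist_source (by omega), hh.dist_target (by omega)]; omega
  · rw [hg.dist_source (by omega), hh.dist_source (by omega)]
  · rw [hg.dist_source (by omega)]
    exact le_trans (by exact_mod_cast hi) hG

/-- The geodesic subpaths of a track to `y` are nearly efficient ways toward `z`. -/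
theorem IsTrack.dist_add_le {δ ε D G : ℕ} {x y z : V} {g h f : ℕ → V} {n : ℕ} (hK : K.Connected)
    (hf : IsTrack K δ ε D x y g f n) (hfork : IsFork K δ G x y z g h) {s t : ℕ} (ht : t ≤ n)
    (hst : s + (driftBound δ D + 4 * (D + δ)) < t) (hgeo : K.dist (f s) (f t) = t - s)
    (hG : K.dist x (f t) + D ≤ G) :
    (t - s) + K.dist (f t) z ≤ K.dist (f s) z + 4 * (D + δ) := by
  have hu := hf.dist_lt hK (s := s) (t := t) (by omega) ht
  have close : ∀ r ≤ n, K.dist x (f r) + D ≤ G → ∃ i ≤ G, K.dist (f r) (h i) ≤ D + δ ∧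
      i ≤ K.dist x (f r) + D ∧ K.dist x (f r) ≤ i + D := by
    intro r hr hrG
    obtain ⟨i, hi, hi'⟩ := hf.close r hr
    have h1 := hK.dist_triangle (u := x) (v := f r) (w := g i)
    have h2 := hK.dist_triangle (u := x) (v := g i) (w := f r)
    rw [SimpleGraph.dist_comm (u := g i)] at h2
    rw [hfork.left.dist_source hi] at h1 h2
    have h3 := hfork.dist_le i (by omega)
    have h4 := hK.dist_triangle (u := f r) (v := g i) (w := h i)
    exact ⟨i, by omega, by omega, by omega, by omega⟩
  obtain ⟨i, hi, hi1, hi2, hi3⟩ := close s (by omega) (by omega)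
  obtain ⟨j, hj, hj1, hj2, hj3⟩ := close t ht hG
  have hG' := hfork.le_right
  have h1 := hK.dist_triangle (u := f s) (v := h i) (w := f t)
  have h2 := hK.dist_triangle (u := h i) (v := h j) (w := f t)
  rw [SimpleGraph.dist_comm (u := h j)] at h2
  have h3 := hK.dist_triangle (u := h i) (v := f s) (w := z)
  rw [SimpleGraph.dist_comm (u := h i) (v := f s), hfork.right.dist_target (by omega)] at h3
  have h4 := hK.dist_triangle (u := f t) (v := h j) (w := z)
  rw [hfork.right.dist_target (by omega)] at h4
  rcases le_total i j with hij | hij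
  · have h5 := hfork.right.geo i j (by omega) hij (by omega)
    omega
  · have h5 := hfork.right.geo j i (by omega) hij (by omega)
    rw [SimpleGraph.dist_comm] at h5
    omega

/-- The geodesics to `z` from a vertex close to `h` stay close to `h`. -/
theorem exists_dist_le_of_common_target {δ E : ℕ} (hK : IsHyperbolicGraph δ K) {x z p : V}
    {h h' : ℕ → V} (hh : IsGeodesicFromTo K h x z) (hh' : IsGeodesicFromTo K h' p z) {i r : ℕ}
    (hi : i ≤ K.dist x z) (hp : K.dist p (h i) ≤ E) (hr : r ≤ K.dist p z) :
    ∃ j ≤ K.dist x z, K.dist (h' r) (h j) ≤ δ + 2 * E := by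
  have hc := hK.1
  obtain ⟨ρ, hρ⟩ : ∃ ρ, ρ = K.dist p z - r := ⟨_, rfl⟩
  have e1 : K.dist z (h' r) = ρ := by rw [SimpleGraph.dist_comm, hh'.dist_target hr, hρ]
  have e2 : K.dist (h' r) p = r := by rw [SimpleGraph.dist_comm, hh'.dist_source hr]
  have e3 : K.dist z (h i) = K.dist x z - i := by rw [SimpleGraph.dist_comm, hh.dist_target hi]
  have e4 := SimpleGraph.dist_comm (G := K) (u := p) (v := z)
  have t1 := hc.dist_triangle (u := z) (v := h i) (w := p)
  rw [SimpleGraph.dist_comm (u := h i)] at t1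
  rcases le_or_gt (2 * ρ + K.dist p (h i)) (K.dist z p + K.dist z (h i)) with hle | hlt
  · have hρ' : ρ ≤ K.dist x z - i := by omega
    have e5 : K.dist z (h (K.dist x z - ρ)) = ρ := by
      rw [SimpleGraph.dist_comm, hh.dist_target (by omega)]; omega
    have e6 : K.dist (h (K.dist x z - ρ)) (h i) = K.dist x z - ρ - i := by
      rw [SimpleGraph.dist_comm, hh.geo i _ (by omega) (by omega) (by omega)]
    refine ⟨K.dist x z - ρ, by omega, (hK.2 z p (h i) _ _ ?_ ?_ ?_ ?_).trans (by omega)⟩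
    · omega
    · omega
    · omega
    · have : (2 * ρ + K.dist p (h i) : ℝ) ≤ K.dist z p + K.dist z (h i) := by exact_mod_cast hle
      rw [e1]
      unfold gromovProduct
      linarith
  · have t2 := hc.dist_triangle (u := h' r) (v := p) (w := h i)
    exact ⟨i, hi, by omega⟩

/-- A nondecreasing sequence with few values is constant on some step. -/
theorem exists_succ_eq {a : ℕ → ℕ} {m b : ℕ} (ha : ∀ k < m, a k ≤ a (k + 1))
    (hm : a m ≤ a 0 + b) (hb : b < m) : ∃ k < m, a (k + 1) = a k := by
  by_contra! hne
  have : ∀ k ≤ m, a 0 + k ≤ a k := by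
    intro k
    induction k with
    | zero => intro _; omega
    | succ k ih =>
      intro hk
      have h1 := ih (by omega)
      have h2 := ha k (by omega)
      have h3 := hne k (by omega)
      omega
  have := this m le_rfl
  omega

/-- The length of a geodesic subpath that ensures that a redirected path is a local
quasi-geodesic. -/
def cutStep (δ D : ℕ) : ℕ := driftBound δ D + 8 * (D + δ) + 1

/-- The length of a subpath of a section that ensures that the path can be redirected from it. -/
def cutLength (δ D : ℕ) : ℕ := (4 * (D + δ) + 1) * cutStep δ D

theorem cutLength_pos (δ D : ℕ) : 0 < cutLength δ D :=
  Nat.mul_pos (by omega) (by unfold cutStep; omega)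

/-- The path `f` runs through a section after the instant `s`, during the time `cutLength`, before
separating from the geodesics to `z`. It then contains a subpath of length `cutStep` that is
continued by some geodesic to `z` into a geodesic: the function `t ↦ t + |f t - z|` is
nondecreasing and takes few values. -/
theorem IsTrack.exists_efficient {δ ε D G M : ℕ} {x y z : V} {g h f : ℕ → V} {n : ℕ}
    (hK : K.Connected) (hf : IsTrack K δ ε D x y g f n) (hfork : IsFork K δ G x y z g h) {s : ℕ}
    (hδ : 0 < δ) (hs : s + cutLength δ D ≤ n) (hM : cutLength δ D ≤ M)
    (hgeo : ∀ i j, s ≤ i → i ≤ j → j ≤ s + cutLength δ D → j ≤ i + M → K.dist (f i) (f j) = j - i)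
    (hG : K.dist x (f s) + cutLength δ D + D ≤ G) :
    ∃ t, s ≤ t ∧ t + cutStep δ D ≤ s + cutLength δ D ∧
      K.dist (f t) z = cutStep δ D + K.dist (f (t + cutStep δ D)) z := by
  obtain ⟨A, hA⟩ : ∃ A, A = cutStep δ D := ⟨_, rfl⟩
  obtain ⟨m, hm⟩ : ∃ m, m = 4 * (D + δ) + 1 := ⟨_, rfl⟩
  have hC : cutLength δ D = m * A := by rw [hm, hA]; rfl
  have hAdef : A = driftBound δ D + 8 * (D + δ) + 1 := hA
  have hmA : ∀ k ≤ m, k * A ≤ m * A := fun k hk => Nat.mul_le_mul_right _ hk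
  have h2A : 2 * A ≤ m * A := hmA 2 (by omega)
  rw [← hA]
  rw [hC] at hs hM hgeo hG ⊢
  obtain ⟨k, hk, hk'⟩ := exists_succ_eq (a := fun k => s + k * A + K.dist (f (s + k * A)) z)
    (m := m) (b := 4 * (D + δ)) (fun k hk => by
      have h1 := hmA (k + 1) hk
      rw [Nat.succ_mul] at h1
      rw [Nat.succ_mul]
      have h2 := hf.path.dist_le hK (s := s + k * A) (t := s + (k * A + A)) (by omega) (by omega)
      have h3 := hK.dist_triangle (u := f (s + k * A)) (v := f (s + (k * A + A))) (w := z)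
      omega) (by
      have h1 := hgeo s (s + m * A) le_rfl (by omega) le_rfl (by omega)
      have h2 := hf.path.dist_source_le hK x (s := s) (t := s + m * A) (by omega) hs
      have h3 := hf.dist_add_le hK hfork hs (by omega) h1 (by omega)
      simp only [Nat.zero_mul, Nat.add_zero]
      omega) (by omega)
  have h1 := hmA (k + 1) hk
  rw [Nat.succ_mul] at h1
  rw [Nat.succ_mul, ← Nat.add_assoc] at hk'
  exact ⟨s + k * A, by omega, by omega, by omega⟩

theorem localScale_le_mu (δ ε : ℕ) : localScale δ ε ≤ mu δ ε := by
  unfold localScale mu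
  rw [mul_comm]
  refine Nat.mul_le_mul_right _ (Nat.add_le_add (by omega) ?_)
  rw [sq, mul_comm (lam δ) (lam δ), mul_assoc 100, mul_comm (lam δ) δ, ← mul_assoc]
  exact Nat.mul_le_mul_right _ (by unfold lam; omega)

/-- The redirection lemma. If a section of a track to `y`, deep enough inside the part where the
geodesics to `y` and to `z` are close, has length at least `l + cutLength`, then the track can be
redirected to `z` from that section on, without any loss for the deep vertices of the preceding
sections. -/
theorem IsTrack.mem_cylinder_of_long_section {δ ε D G l : ℕ} {x y z : V} {g h f : ℕ → V} {n : ℕ}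
    (hK : IsHyperbolicGraph δ K) (hδ : 0 < δ) (hε : δ + 2 * (D + δ) ≤ 2 * ε)
    (hμ : cutLength δ D ≤ mu δ ε) (hl : mu δ ε ≤ l) (hf : IsTrack K δ ε D x y g f n)
    (hfork : IsFork K δ G x y z g h) {c d : ℕ → ℕ} {k' : ℕ}
    (hsec : IsSectioned K ε (mu δ ε) f c d k') (hlong : HasLongSections l c d k') {s : ℕ}
    (hcs : c k' ≤ s) (hsd : s + cutLength δ D ≤ d k') (hdn : d k' ≤ n)
    (hcl : 0 < k' → c k' + l ≤ s)
    (hG : K.dist x (f s) + cutLength δ D + driftBound δ D + D ≤ G) {k t : ℕ} (hk : k ≤ k')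
    (hct : c k ≤ t) (hfc : f (c k) ≠ x → l ≤ K.dist (f (c k)) (f t))
    (hlt : k < k' → t ≤ d k ∧ l ≤ K.dist (f (d k)) (f t))
    (heq : k = k' → t ≤ s ∧ l + cutLength δ D ≤ K.dist (f t) (f s)) :
    f t ∈ cylinder K δ ε l x z := by
  have hc := hK.1
  have hgeo := hsec.local_geodesic k' le_rfl
  obtain ⟨t₁, hst, ht₁, hz⟩ := hf.exists_efficient hc hfork hδ (s := s) (by omega) hμ
    (fun i j hi hij hj hM => hgeo i j (by omega) hij (by omega) hM) (by omega)
  obtain ⟨A, hA⟩ : ∃ A, A = cutStep δ D := ⟨_, rfl⟩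
  have hAdef : A = driftBound δ D + 8 * (D + δ) + 1 := hA
  obtain ⟨t₂, ht₂⟩ : ∃ t₂, t₂ = t₁ + A := ⟨_, rfl⟩
  rw [← hA] at ht₁ hz
  rw [← ht₂] at ht₁ hz
  -- The redirected path `F` follows `f` up to `t₂`, then a geodesic to `z`; by the choice of `t₁`,
  -- it is a geodesic from `t₁` on.
  obtain ⟨h', hh'⟩ := exists_isGeodesicFromTo hc (f t₂) z
  obtain ⟨n', hn'⟩ : ∃ n', n' = t₂ + K.dist (f t₂) z := ⟨_, rfl⟩
  obtain ⟨F, hF⟩ : ∃ F, F = splice f h' t₂ 0 := ⟨_, rfl⟩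
  have hab : f t₂ = h' 0 := hh'.source.symm
  have Fle : ∀ r ≤ t₂, F r = f r := fun r hr => hF ▸ splice_of_le hr
  have Fge : ∀ r, t₂ ≤ r → F r = h' (r - t₂) := fun r hr => hF ▸ splice_of_ge hab hr
  have Fpath : IsVertexPath K F n' := by
    have := hf.path.splice hh'.geo.isVertexPath hab (by omega) (Nat.zero_le _)
    rwa [Nat.sub_zero, ← hn', ← hF] at this
  have Fend : F n' = z := by
    rw [Fge n' (by omega), hn', Nat.add_sub_cancel_left, hh'.target]
  have Fgeo : IsGeodesicOn K F t₁ n' := by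
    refine Fpath.isGeodesicOn hc le_rfl ?_
    rw [Fend, Fle t₁ (by omega)]
    omega
  have hut₂ : K.dist x (f t₂) + driftBound δ D + D ≤ G := by
    have := hf.path.dist_source_le hc x (s := s) (t := t₂) (by omega) (by omega)
    omega
  have close : ∀ r ≤ t₂, ∃ i ≤ K.dist x z, K.dist (f r) (h i) ≤ D + δ := by
    intro r hr
    obtain ⟨i, hi, hi'⟩ := hf.close r (by omega)
    have h1 := hc.dist_triangle (u := x) (v := f r) (w := g i)
    rw [hfork.left.dist_source hi] at h1
    have h2 := hf.dist_le_add hc hr (by omega)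
    have h3 := hfork.dist_le i (by omega)
    have h4 := hc.dist_triangle (u := f r) (v := g i) (w := h i)
    have h5 := hfork.le_right
    exact ⟨i, by omega, by omega⟩
  have hL := localScale_le_mu δ ε
  have hd : ∀ i < k', d i ≤ s := fun i hi => (hsec.d_le_c_of_lt hi le_rfl).trans hcs
  -- The new sections: the last old one stops at `t₁`, where the new one starts.
  have hcoarse : IsCoarsePath K δ ε l x z F n' (fun i => if i ≤ k' then c i else t₁)
      (fun i => if i < k' then d i else if i = k' then t₁ else n') (k' + 1) := by
    refine ⟨Fpath, by rw [Fle 0 (by omega), hf.source], Fend, ⟨?_, ?_, ?_, ?_, ?_⟩, ?_, ?_, ?_, ?_⟩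
    · simpa using hsec.start
    · intro i hi
      have := hsec.c_le_d i
      split_ifs with h1 h2 h3 h4 <;> first | omega | (rw [h3]; omega)
    · intro i hi
      have := hsec.d_le_c i
      split_ifs <;> omega
    · intro i hi
      have := hsec.bridge i
      split_ifs <;> omega
    · intro i hi a b ha hab' hb hM
      rcases lt_trichotomy i k' with hik | hik | hik
      · rw [if_pos hik.le] at ha
        rw [if_pos hik] at hb
        have := hd i hik
        rw [Fle a (by omega), Fle b (by omega)]
        exact hsec.local_geodesic i hik.le a b ha hab' hb hM
      · rw [if_pos hik.le] at ha
        rw [if_neg (by omega), if_pos hik] at hb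
        rw [Fle a (by omega), Fle b (by omega)]
        exact hgeo a b (by rwa [← hik]) hab' (by omega) hM
      · rw [if_neg (by omega)] at ha
        rw [if_neg (by omega), if_neg (by omega)] at hb
        exact Fgeo a b ha hab' hb
    · simp
    · intro i hi0 hik
      have := hlong i hi0
      dsimp only
      split_ifs with h1 h2 h3 h4
      · exact this h2
      · rw [h3]
        have := hcl (by omega)
        omega
      all_goals omega
    · intro i j hij hj hjL
      rcases le_or_gt j t₂ with h1 | h1
      · rw [Fle i (by omega), Fle j h1]
        exact hf.localQuasi i j hij (by omega) hjL
      rcases le_or_gt t₁ i with h2 | h2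
      · rw [Fgeo i j h2 hij hj]
        have : j - i ≤ 500 * δ * (j - i) := Nat.le_mul_of_pos_left _ (by omega)
        omega
      -- A subpath that starts before `t₁` and ends after `t₂` contains the geodesic `[t₁, t₂]`, and
      -- its part before `t₂` is a geodesic: at most `4 * (D + δ)` is lost, which is less than half
      -- of its length.
      · have hci : c k' ≤ i := by
          rcases Nat.eq_zero_or_pos k' with h0 | h0
          · rw [h0, hsec.start]; omega
          · have := hcl h0; omega
        rw [Fle i (by omega), Fge j h1.le]
        have h3 := hgeo i t₂ hci (by omega) (by omega) (by omega)
        have h4 := hf.dist_add_le hc hfork (s := i) (t := t₂) (by omega) (by omega) h3 (by omega)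
        have h5 := hc.dist_triangle (u := f i) (v := h' (j - t₂)) (w := z)
        rw [hh'.dist_target (by omega)] at h5
        have h6 : 2 * K.dist (f i) (h' (j - t₂)) ≤ 500 * δ * K.dist (f i) (h' (j - t₂)) :=
          Nat.mul_le_mul_right _ (by omega)
        omega
    · refine ⟨h, hfork.right, fun r hr => ?_⟩
      rcases le_or_gt r t₂ with h1 | h1
      · rw [Fle r h1]
        obtain ⟨i, hi, hi'⟩ := close r h1
        exact ⟨i, hi, by omega⟩
      · rw [Fge r h1.le]
        obtain ⟨i, hi, hi'⟩ := close t₂ le_rfl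
        obtain ⟨j, hj, hj'⟩ := exists_dist_le_of_common_target hK hfork.right hh' hi hi'
          (r := r - t₂) (by omega)
        exact ⟨j, hj, by omega⟩
  have hts : t ≤ t₁ := by
    rcases hk.lt_or_eq with h1 | h1
    · have := hd k h1
      have := hlt h1
      omega
    · have := heq h1
      omega
  rw [← Fle t (by omega)]
  refine hcoarse.mem_cylinder hδ hc (k := k) (t := t) (by omega) ⟨?_, ?_, ?_, ?_⟩
  · simpa [hk] using hct
  · split_ifs with h1
    · exact (hlt h1).1
    all_goals omega
  · rw [if_pos hk, Fle (c k) (by omega), Fle t (by omega)]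
    exact hfc
  · intro _
    rw [Fle t (by omega)]
    split_ifs with h1 h2
    · have := hd k h1
      rw [Fle _ (by omega)]
      exact (hlt h1).2
    · rw [Fle _ (by omega)]
      have h3 := hc.dist_triangle (u := f t) (v := f t₁) (w := f s)
      have h4 := hf.path.dist_le hc hst (by omega)
      rw [SimpleGraph.dist_comm (u := f s)] at h4
      rw [SimpleGraph.dist_comm]
      have := (heq h2).2
      omega
    · omega

/-! ### Passages of the bad paths at a given distance from the origin -/

theorem localScale_ge {δ ε E : ℕ} (hε : 0 < ε) (hE : E ≤ 2 * ε) :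
    2 * (500 * δ * (8 * E + 3)) ≤ localScale δ ε := by
  unfold localScale lam
  calc 2 * (500 * δ * (8 * E + 3)) = 1000 * δ * (8 * E + 3) := by ring
    _ ≤ 1000 * δ * (40 * (ε + 100 * (1000 * δ) * δ)) := Nat.mul_le_mul_left _ (by omega)
    _ = 40 * (1000 * δ) * (ε + 100 * (1000 * δ) * δ) := by ring

/-- `D` is a Morse constant for the `Λ`-quasi-geodesics of `K`. -/
def IsMorseConstant (K : SimpleGraph V) (Λ D : ℕ) : Prop :=
  ∀ (x y : V) (g p : ℕ → V) (n : ℕ), IsGeodesicFromTo K g x y → IsVertexPath K p n →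
    p 0 = x → p n = y → IsQuasiGeo K Λ p n → IsCloseTo K D x y g p n

theorem IsCoarsePath.isTrack {δ ε D l : ℕ} (hK : K.Connected) (hδ : 0 < δ) (hε : 0 < ε)
    (hD : IsMorseConstant K (1000 * δ) D) {x y : V} {g f : ℕ → V} {n : ℕ} {c d : ℕ → ℕ} {m : ℕ}
    (hf : IsCoarsePath K δ ε l x y f n c d m) (hg : IsGeodesicFromTo K g x y) :
    IsTrack K δ ε D x y g f n := by
  obtain ⟨g', hg', hclose⟩ := hf.near
  have hq := hf.localQuasi.isQuasiGeo (by omega) hK hf.path hf.source hg' hclose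
    (localScale_ge hε le_rfl)
  rw [show 2 * (500 * δ) = 1000 * δ by ring] at hq
  exact ⟨hg, hf.path, hf.source, hf.target, hf.localQuasi, hq,
    hD x y g f n hg hf.path hf.source hf.target hq⟩

/-- The `l`-cylinder of `(x, y)` is not contained in the one of `(x, z)` in the ball of radius `R`
around `x`. -/
def IsBadScale (K : SimpleGraph V) (δ ε R : ℕ) (x y z : V) (l : ℕ) : Prop :=
  ∃ w ∈ cylinder K δ ε l x y, K.dist x w ≤ R ∧ w ∉ cylinder K δ ε l x z

/-- The track `f` has a deep vertex `f t = w` in the section number `k`, and follows later, in the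
section number `j`, a path of length `mu` issued from `f s`, at a distance about `Q` from `x`. The
length `T` bounds the length of the sections that are too short to be redirected. The sections up to the number `j + 1` have length at least `l`, the first one excepted. -/
structure IsPassage (K : SimpleGraph V) (δ ε D l T Q : ℕ) (x y w : V) (g f : ℕ → V) (n : ℕ)
    (c d : ℕ → ℕ) (k t j s : ℕ) : Prop where
  track : IsTrack K δ ε D x y g f n
  sectioned : IsSectioned K ε (mu δ ε) f c d (j + 1)
  long : HasLongSections l c d (j + 2)
  d_le : d (j + 1) ≤ n
  k_lt : k < j
  c_le_t : c k ≤ t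
  t_le_d : t ≤ d k
  far_c : f (c k) ≠ x → l ≤ K.dist (f (c k)) (f t)
  far_d : l ≤ K.dist (f (d k)) (f t)
  vertex : f t = w
  c_le_s : c j ≤ s
  le_d : s + mu δ ε ≤ d j
  le_add : ∀ r ≤ mu δ ε, K.dist x (f (s + r)) ≤ Q + (2 * mu δ ε + ε)
  le_dist : ∀ r ≤ mu δ ε, Q ≤ K.dist x (f (s + r)) + (2 * mu δ ε + ε)
  c_near : K.dist x (f (c j)) ≤ Q + T
  c_succ_near : K.dist x (f (c (j + 1))) ≤ Q + 3 * T

/-- The sections of a bad path that follow the bad vertex are too short to be redirected; thus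
there are many of them before the distance `G`. -/
theorem IsBadScale.exists_isPassage {δ ε D G R T l : ℕ} {x y z : V} {g h : ℕ → V}
    (hK : IsHyperbolicGraph δ K) (hδ : 0 < δ) (hε₀ : 0 < ε)
    (hD : IsMorseConstant K (1000 * δ) D) (hε : δ + 2 * (D + δ) ≤ 2 * ε)
    (hμ : cutLength δ D ≤ mu δ ε) (hl : mu δ ε ≤ l)
    (hT : l + mu δ ε + ε + cutLength δ D + driftBound δ D + D < T) (hG : R + 10 * T ≤ G)
    (hfork : IsFork K δ G x y z g h) (hbad : IsBadScale K δ ε R x y z l) :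
    ∃ (w : V) (f : ℕ → V) (n : ℕ) (c d : ℕ → ℕ) (k t j s : ℕ),
      IsPassage K δ ε D l T (R + 2 * T) x y w g f n c d k t j s ∧
        w ∉ cylinder K δ ε l x z := by
  have hc := hK.1
  obtain ⟨w, hw, hwR, hwz⟩ := hbad
  obtain ⟨f, n, c, d, m, k, t, hf, hkm, hdeep, rfl⟩ := exists_isCoarsePath_of_mem_cylinder hδ hc hw
  have htr := hf.isTrack hc hδ hε₀ hD hfork.left
  have hxy := hfork.le_left
  have hdn : ∀ i ≤ m, d i ≤ n := fun i hi => hf.finish ▸ hf.sectioned.d_le_d hi le_rfl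
  have hcn : ∀ i ≤ m, c i ≤ n := fun i hi => (hf.sectioned.c_le_d i hi).trans (hdn i hi)
  have htn : t ≤ n := hdeep.le_d.trans (hdn k hkm)
  -- The end `y` is far.
  have hfar : ∀ r ≤ n, ∀ M, K.dist x (f r) + M ≤ G → r + M ≤ n := by
    intro r hr M hM
    have h1 := hc.dist_triangle (u := x) (v := f r) (w := y)
    have h2 := htr.path.dist_le hc hr le_rfl
    rw [htr.target] at h2
    omega
  have hcut := fun (k' : ℕ) (hk' : k' ≤ m) (hlong : HasLongSections l c d k') (s k : ℕ) =>
    htr.mem_cylinder_of_long_section (s := s) (k := k) (t := t) hK hδ hε hμ hl hfork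
      (hf.sectioned.mono hk') hlong
  have hlong : ∀ k' ≤ m, HasLongSections l c d k' := fun k' hk' i hi hik => hf.long i hi (by omega)
  -- The section of the bad vertex.
  obtain ⟨s₀, hs₀t, hs₀n, hs₀⟩ :
      ∃ s₀, t ≤ s₀ ∧ s₀ ≤ n ∧ K.dist (f t) (f s₀) = l + cutLength δ D := by
    obtain ⟨r, hr, hr'⟩ := exists_eq_of_lipschitz (u := fun r => K.dist (f t) (f (t + r)))
      (n := n - t) (a := l + cutLength δ D) (by simp) (by
        rw [Nat.add_sub_cancel' htn, htr.target]
        have := hc.dist_triangle (u := x) (v := f t) (w := y)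
        omega)
      (fun r hr => htr.path.dist_succ_le hc (f t) (t := t + r) (by omega))
    exact ⟨t + r, by omega, by omega, hr'⟩
  have hus₀ : K.dist x (f s₀) ≤ R + l + cutLength δ D := by
    have := hc.dist_triangle (u := x) (v := f t) (w := f s₀)
    omega
  have hs₀C := hfar s₀ hs₀n (cutLength δ D) (by omega)
  have hts₀ := htr.path.dist_le hc hs₀t hs₀n
  have hdk : d k < s₀ + cutLength δ D := by
    by_contra! hle
    refine hwz (hcut k hkm (hlong k hkm) s₀ k (hdeep.c_le.trans hs₀t) hle
      (hdn k hkm) (fun _ => ?_) (by omega) le_rfl hdeep.c_le hdeep.far_c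
      (fun h => absurd h (lt_irrefl k)) fun _ => ⟨hs₀t, hs₀.ge⟩)
    have := hdeep.c_le
    omega
  have hkm' : k < m := by
    rcases hkm.lt_or_eq with h1 | h1
    · exact h1
    · rw [h1, hf.finish] at hdk
      omega
  have hbefore : ∀ r ≤ d k, K.dist x (f r) < R + 2 * T := by
    intro r hr
    have h1 := htr.dist_le_add hc (s := r) (t := s₀ + cutLength δ D) (by omega) hs₀C
    have h2 := htr.path.dist_source_le hc x (s := s₀) (t := s₀ + cutLength δ D) (by omega) hs₀C
    omega
  have hfard : l ≤ K.dist (f (d k)) (f t) := by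
    refine hdeep.far_d fun h => ?_
    have := hbefore (d k) le_rfl
    rw [h] at this
    omega
  -- The following sections.
  have hafter : ∀ i, k < i → i ≤ m → K.dist x (f (c i)) ≤ R + 2 * T + 3 * T →
      d i < c i + l + cutLength δ D ∧ i < m := by
    intro i hki him hu
    have h1 := hfar (c i) (hcn i him) (l + cutLength δ D) (by omega)
    have h2 : d i < c i + l + cutLength δ D := by
      by_contra! hle
      have h3 := htr.path.dist_source_le hc x (s := c i) (t := c i + l) (by omega) (by omega)
      exact hwz (hcut i him (hlong i him) (c i + l) k (by omega) hle
        (hdn i him) (fun _ => le_rfl) (by omega) hki.le hdeep.c_le hdeep.far_c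
        (fun _ => ⟨hdeep.le_d, hfard⟩) fun h => absurd h hki.ne)
    refine ⟨h2, lt_of_le_of_ne him fun h => ?_⟩
    rw [h, hf.finish] at h2
    rw [h] at h1
    omega
  -- At the instant `τ` the path is at the distance `R + 2 * T` from `x`; the section number `j` is the
  -- first one that ends late enough after `τ` to follow a path of length `mu` from there.
  obtain ⟨τ, hτn, hτ⟩ : ∃ τ ≤ n, K.dist x (f τ) = R + 2 * T :=
    exists_eq_of_lipschitz (u := fun r => K.dist x (f r)) (by rw [htr.source]; simp)
      (by rw [htr.target]; omega) (fun r hr => htr.path.dist_succ_le hc x hr)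
  have hkτ : d k < τ := by
    by_contra! hle
    have := hbefore τ hle
    omega
  have hτ' := hfar τ hτn (2 * mu δ ε + ε) (by omega)
  classical
  have hex : ∃ j, τ + mu δ ε ≤ d j := ⟨m, by rw [hf.finish]; omega⟩
  obtain ⟨j, hj⟩ : ∃ j, j = Nat.find hex := ⟨_, rfl⟩
  have hj₁ : τ + mu δ ε ≤ d j := hj ▸ Nat.find_spec hex
  have hj₂ : ∀ i < j, d i < τ + mu δ ε := fun i hi => by
    have := Nat.find_min hex (hj ▸ hi)
    omega
  have hjm : j ≤ m := hj ▸ Nat.find_min' hex (by rw [hf.finish]; omega)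
  have hkj : k < j := by
    by_contra! hle
    have := hf.sectioned.d_le_d hle hkm
    omega
  have hcj : c j ≤ τ + mu δ ε + ε := by
    obtain ⟨i, rfl⟩ : ∃ i, j = i + 1 := ⟨j - 1, by omega⟩
    have h1 := hj₂ i (by omega)
    have h2 := hf.sectioned.bridge i (by omega)
    omega
  have hucj : K.dist x (f (c j)) ≤ R + 2 * T + T := by
    rcases le_total (c j) τ with h1 | h1
    · have := htr.dist_le_add hc h1 hτn
      omega
    · have := htr.path.dist_source_le hc x h1 (by omega)
      omega
  obtain ⟨hdj, hjm'⟩ := hafter j hkj hjm (by omega)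
  have hbridge := hf.sectioned.bridge j hjm'
  have hcd := hf.sectioned.d_le_c j hjm'
  have hcd' := hf.sectioned.c_le_d j hjm
  have hucj' : K.dist x (f (c (j + 1))) ≤ R + 2 * T + 3 * T := by
    have := htr.path.dist_source_le hc x (s := c j) (t := c (j + 1)) (by omega) (hcn _ hjm')
    omega
  obtain ⟨-, hjm''⟩ := hafter (j + 1) (by omega) hjm' hucj'
  obtain ⟨s, hs⟩ : ∃ s, s = max τ (c j) := ⟨_, rfl⟩
  have hsd : s + mu δ ε ≤ d j := by
    have := hf.long j (by omega) hjm'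
    omega
  have hdjn := hdn j hjm
  refine ⟨f t, f, n, c, d, k, t, j, s, ⟨htr, hf.sectioned.mono hjm',
    fun i hi hij => hf.long i hi (by omega), hdn _ hjm', hkj, hdeep.c_le, hdeep.le_d, hdeep.far_c,
    hfard, rfl, by omega, hsd, fun r hr => ?_, fun r hr => ?_, hucj, hucj'⟩, hwz⟩
  · have := htr.path.dist_source_le hc x (s := τ) (t := s + r) (by omega) (by omega)
    omega
  · have h1 := htr.path.dist_le hc (s := τ) (t := s + r) (by omega) (by omega)
    have h2 := hc.dist_triangle (u := x) (v := f (s + r)) (w := f τ)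
    rw [SimpleGraph.dist_comm (u := f (s + r)) (v := f τ)] at h2
    omega

/-! ### Splicing two passages -/

/-- Two tracks that follow the same path of length `mu` can be spliced. The section of the first
one in which this happens takes the end of the one of the second, and is followed by the next
section of the second. -/
theorem IsPassage.exists_splice {δ ε D l l' T Q : ℕ} {x y w w' : V} {g f f' : ℕ → V} {n n' : ℕ}
    {c d c' d' : ℕ → ℕ} {k t j s k' t' j' s' : ℕ} (hK : K.Connected) (hδ : 0 < δ) (hε : 0 < ε)
    (hD : D ≤ 2 * ε) (hp : IsPassage K δ ε D l T Q x y w g f n c d k t j s)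
    (hp' : IsPassage K δ ε D l' T Q x y w' g f' n' c' d' k' t' j' s')
    (heq : ∀ r ≤ mu δ ε, f (s + r) = f' (s' + r)) :
    ∃ (F : ℕ → V) (N : ℕ) (a b : ℕ → ℕ), IsTrack K δ ε D x y g F N ∧
      IsSectioned K ε (mu δ ε) F a b (j + 1) ∧ (∀ i ≤ j, a i = c i) ∧ (∀ i < j, b i = d i) ∧
      b j = s + (d' j' - s') ∧ a (j + 1) = s + (c' (j' + 1) - s') ∧
      b (j + 1) = s + (d' (j' + 1) - s') ∧ b (j + 1) ≤ N ∧ (∀ r ≤ s, F r = f r) ∧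
      ∀ r, s' ≤ r → F (s + (r - s')) = f' r := by
  obtain ⟨F, hF⟩ : ∃ F, F = splice f f' s s' := ⟨_, rfl⟩
  have hab : f s = f' s' := heq 0 (Nat.zero_le _)
  have Fle : ∀ r ≤ s + mu δ ε, F r = f r := by
    intro r hr
    rcases le_or_gt r s with h | h
    · exact hF ▸ splice_of_le h
    · rw [hF, splice_of_ge hab h.le, add_comm (r - s), ← heq (r - s) (by omega)]
      exact congrArg f (by omega)
  have Fge : ∀ r, s ≤ r → F r = f' (s' + (r - s)) := by
    intro r hr
    rw [hF, splice_of_ge hab hr, add_comm]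
  have hcd := hp.sectioned.d_le_c j (by omega)
  have hcd' := hp.sectioned.c_le_d (j + 1) (by omega)
  have hcd2 := hp'.sectioned.d_le_c j' (by omega)
  have hcd2' := hp'.sectioned.c_le_d (j' + 1) (by omega)
  have hbr := hp'.sectioned.bridge j' (by omega)
  have hsd := hp.le_d
  have hsd' := hp'.le_d
  have hdn := hp.d_le
  have hdn' := hp'.d_le
  have hcs := hp.c_le_s
  have hcs' := hp'.c_le_s
  obtain ⟨N, hN⟩ : ∃ N, N = s + (n' - s') := ⟨_, rfl⟩
  have hL := localScale_le_mu δ ε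
  have Fpath : IsVertexPath K F N := by
    rw [hF, hN]
    exact hp.track.path.splice hp'.track.path hab (by omega) (by omega)
  have Fsource : F 0 = x := by rw [Fle 0 (by omega), hp.track.source]
  have Ftarget : F N = y := by
    rw [Fge N (by omega), ← hp'.track.target]
    exact congrArg f' (by omega)
  have Flocal : IsLocalQuasiGeo K (localScale δ ε) (500 * δ) F N := by
    intro p q hpq hq hqL
    rcases le_or_gt q (s + mu δ ε) with h | h
    · rw [Fle p (by omega), Fle q h]
      exact hp.track.localQuasi p q hpq (by omega) hqL
    · rw [Fge p (by omega), Fge q (by omega)]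
      have := hp'.track.localQuasi (s' + (p - s)) (s' + (q - s)) (by omega) (by omega) (by omega)
      omega
  have Fclose : IsCloseTo K D x y g F N := by
    intro r hr
    rcases le_or_gt r s with h | h
    · rw [Fle r (by omega)]
      exact hp.track.close r (by omega)
    · rw [Fge r h.le]
      exact hp'.track.close _ (by omega)
  have Fquasi := Flocal.isQuasiGeo (by omega) hK Fpath Fsource hp.track.geodesic Fclose
    (localScale_ge hε hD)
  rw [show 2 * (500 * δ) = 1000 * δ by ring] at Fquasi
  refine ⟨F, N, fun i => if i ≤ j then c i else s + (c' (j' + 1) - s'),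
    fun i => if i < j then d i else if i = j then s + (d' j' - s') else s + (d' (j' + 1) - s'),
    ⟨hp.track.geodesic, Fpath, Fsource, Ftarget, Flocal, Fquasi, Fclose⟩, ⟨?_, ?_, ?_, ?_, ?_⟩,
    fun i hi => if_pos hi, fun i hi => if_pos hi, by simp, by simp, by simp, ?_,
    fun r hr => Fle r (by omega), fun r hr => ?_⟩
  · simpa using hp.sectioned.start
  · intro i hi
    have := hp.sectioned.c_le_d i (by omega)
    split_ifs with h1 h2 h3 h4 <;> first | omega | (rw [h3]; omega)
  · intro i hi
    have := hp.sectioned.d_le_c i (by omega)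
    split_ifs <;> omega
  · intro i hi
    have := hp.sectioned.bridge i (by omega)
    split_ifs <;> omega
  · intro i hi p q hpa hpq hq hqM
    rcases lt_trichotomy i j with hij | hij | hij
    · rw [if_pos hij.le] at hpa
      rw [if_pos hij] at hq
      have := hp.sectioned.d_le_c_of_lt hij (by omega)
      rw [Fle p (by omega), Fle q (by omega)]
      exact hp.sectioned.local_geodesic i (by omega) p q hpa hpq hq hqM
    · rw [if_pos hij.le, hij] at hpa
      rw [if_neg (by omega), if_pos hij] at hq
      rcases le_or_gt q (s + mu δ ε) with h | h
      · rw [Fle p (by omega), Fle q h]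
        exact hp.sectioned.local_geodesic j (by omega) p q hpa hpq (by omega) hqM
      · rw [Fge p (by omega), Fge q (by omega), hp'.sectioned.local_geodesic j' (by omega)
          (s' + (p - s)) (s' + (q - s)) (by omega) (by omega) (by omega) (by omega)]
        omega
    · rw [if_neg (by omega)] at hpa
      rw [if_neg (by omega), if_neg (by omega)] at hq
      rw [Fge p (by omega), Fge q (by omega), hp'.sectioned.local_geodesic (j' + 1) le_rfl
          (s' + (p - s)) (s' + (q - s)) (by omega) (by omega) (by omega) (by omega)]
      omega
  · dsimp only
    rw [if_neg (by omega), if_neg (by omega)]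
    omega
  · rw [Fge _ (by omega)]
    exact congrArg f' (by omega)

/-- If the second track stays longer in its section than the first one, then the section of the
spliced track is long enough to be redirected. -/
theorem IsPassage.mem_cylinder_of_longer {δ ε D l l' T Q G : ℕ} {x y z w w' : V}
    {g h f f' : ℕ → V} {n n' : ℕ} {c d c' d' : ℕ → ℕ} {k t j s k' t' j' s' : ℕ}
    (hK : IsHyperbolicGraph δ K) (hδ : 0 < δ) (hε₀ : 0 < ε) (hε : δ + 2 * (D + δ) ≤ 2 * ε)
    (hμ : cutLength δ D ≤ mu δ ε) (hl : mu δ ε ≤ l)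
    (hT : l + mu δ ε + ε + cutLength δ D + driftBound δ D + D < T) (hG : Q + 8 * T ≤ G)
    (hfork : IsFork K δ G x y z g h)
    (hp : IsPassage K δ ε D l T Q x y w g f n c d k t j s)
    (hp' : IsPassage K δ ε D l' T Q x y w' g f' n' c' d' k' t' j' s')
    (heq : ∀ r ≤ mu δ ε, f (s + r) = f' (s' + r))
    (hlonger : d j - s + cutLength δ D ≤ d' j' - s') : w ∈ cylinder K δ ε l x z := by
  obtain ⟨F, N, a, b, hF, hsec, ha, hb, hbj, -, hbj1, hbN, Fle, -⟩ :=
    hp.exists_splice hK.1 hδ hε₀ (by omega) hp' heq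
  have h1 := hp.c_le_s
  have h2 := hp.le_d
  have h3 := hp.sectioned.d_le_c_of_lt hp.k_lt (by omega)
  have h4 := hp.long j (by have := hp.k_lt; omega) (by omega)
  have h5 := hsec.d_le_d (i := j) (j := j + 1) (by omega) le_rfl
  have h6 := hF.path.dist_source_le hK.1 x (s := c j) (t := c j + l) (by omega) (by omega)
  have h7 := hp.c_near
  have h8 := hp.t_le_d
  have h9 := hp.c_le_t
  have hlong : HasLongSections l a b j := by
    intro i hi hij
    rw [ha i hij.le, hb i hij]
    exact hp.long i hi (by omega)
  rw [Fle (c j) h1] at h6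
  rw [← hp.vertex, ← Fle t (by omega)]
  refine hF.mem_cylinder_of_long_section hK hδ hε hμ hl hfork (hsec.mono (by omega)) hlong
    (s := c j + l) (k := k) ?_ ?_ ?_ ?_ ?_ hp.k_lt.le ?_ ?_ ?_ fun h => absurd h hp.k_lt.ne
  · rw [ha j le_rfl]; omega
  · omega
  · omega
  · rw [ha j le_rfl]; exact fun _ => le_rfl
  · omega
  · rw [ha k hp.k_lt.le]; exact h9
  · rw [ha k hp.k_lt.le, Fle _ (by omega), Fle _ (by omega)]
    exact hp.far_c
  · intro hkj
    rw [hb k hkj, Fle _ (by omega), Fle _ (by omega)]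
    exact ⟨h8, hp.far_d⟩

/-- If the second track stays at least as long in its section as the first one, and has longer
sections, then the next section of the spliced track is long enough to be redirected. -/
theorem IsPassage.mem_cylinder_of_le {δ ε D l l' T Q G : ℕ} {x y z w w' : V}
    {g h f f' : ℕ → V} {n n' : ℕ} {c d c' d' : ℕ → ℕ} {k t j s k' t' j' s' : ℕ}
    (hK : IsHyperbolicGraph δ K) (hδ : 0 < δ) (hε₀ : 0 < ε) (hε : δ + 2 * (D + δ) ≤ 2 * ε)
    (hμ : cutLength δ D ≤ mu δ ε) (hl : mu δ ε ≤ l) (hll' : l + cutLength δ D ≤ l')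
    (hT : l + mu δ ε + ε + cutLength δ D + driftBound δ D + D < T) (hG : Q + 8 * T ≤ G)
    (hfork : IsFork K δ G x y z g h)
    (hp : IsPassage K δ ε D l T Q x y w g f n c d k t j s)
    (hp' : IsPassage K δ ε D l' T Q x y w' g f' n' c' d' k' t' j' s')
    (heq : ∀ r ≤ mu δ ε, f (s + r) = f' (s' + r))
    (hle : d j - s ≤ d' j' - s') : w ∈ cylinder K δ ε l x z := by
  obtain ⟨F, N, a, b, hF, hsec, ha, hb, hbj, haj1, hbj1, hbN, Fle, Fge⟩ :=
    hp.exists_splice hK.1 hδ hε₀ (by omega) hp' heq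
  have h1 := hp.c_le_s
  have h2 := hp.le_d
  have h3 := hp.sectioned.d_le_c_of_lt hp.k_lt (by omega)
  have h4 := hp.long j (by have := hp.k_lt; omega) (by omega)
  have h5 := hp'.long (j' + 1) (by omega) (by omega)
  have h6 := hp'.track.path.dist_source_le hK.1 x (s := c' (j' + 1)) (t := c' (j' + 1) + l)
    (by omega) (by have := hp'.d_le; omega)
  have h7 := hp'.c_succ_near
  have h8 := hp.t_le_d
  have h9 := hp.c_le_t
  have h10 := hp'.le_d
  have h11 := hp'.sectioned.d_le_c j' (by omega)
  have hlong : HasLongSections l a b (j + 1) := by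
    intro i hi hij
    rcases (Nat.lt_succ_iff.1 hij).lt_or_eq with h | h
    · rw [ha i h.le, hb i h]
      exact hp.long i hi (by omega)
    · rw [h, ha j le_rfl, hbj]
      omega
  rw [← hp.vertex, ← Fle t (by omega)]
  have hk : k ≤ j := hp.k_lt.le
  refine hF.mem_cylinder_of_long_section hK hδ hε hμ hl hfork hsec hlong
    (s := a (j + 1) + l) (k := k) (by omega) (by omega) hbN (fun _ => le_rfl) ?_ (by omega) ?_ ?_ ?_
    (by omega)
  · rw [haj1, show s + (c' (j' + 1) - s') + l = s + (c' (j' + 1) + l - s') by omega,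
      Fge _ (by omega)]
    omega
  · rw [ha k hk]; exact h9
  · rw [ha k hk, Fle _ (by omega), Fle _ (by omega)]
    exact hp.far_c
  · intro _
    rw [hb k hp.k_lt, Fle _ (by omega), Fle _ (by omega)]
    exact ⟨h8, hp.far_d⟩

/-! ### Counting the bad scales -/

/-- `ε` is a constant for the conical stability of the `Λ`-quasi-geodesics of `K`. -/
def IsConicalConstant (K : SimpleGraph V) (Λ ε : ℕ) : Prop :=
  ∀ (x y : V) (g p : ℕ → V) (n : ℕ), x ≠ y → IsGeodesicFromTo K g x y → IsVertexPath K p n →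
    p 0 = x → p n = y → IsQuasiGeo K Λ p n → ∀ t ≤ n, ∃ i < K.dist x y,
      p t ∈ cone K ε ε (g i) (g (i + 1)) ∨ p t ∈ cone K ε ε (g (i + 1)) (g i)

/-- A bound for the number of vertices that the paths of length `mu` of the passages may visit, if
cones have at most `B` vertices. -/
def channelSize (δ ε B : ℕ) : ℕ := (4 * mu δ ε + 4 * ε + 3) * (2 * B)

/-- A bound for the number of bad scales of a triangle: there is at most one for each path of
length `mu` and each residue modulo `cutLength`. -/
def scaleCount (δ ε D B : ℕ) : ℕ :=
  (channelSize δ ε B + 1) ^ (mu δ ε + 1) * cutLength δ D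

/-- The vertices of a track at a given distance from its origin lie in a bounded number of
cones. -/
theorem exists_finset_of_isTrack {δ ε D B Q : ℕ} {x y : V} {g : ℕ → V} (hK : K.Connected)
    (hcon : IsConicalConstant K (1000 * δ) ε)
    (hB : ∀ a b : V, K.Adj a b → ∃ F : Finset V, cone K ε ε a b ⊆ F ∧ F.card ≤ B)
    (hxy : x ≠ y) (hg : IsGeodesicFromTo K g x y) :
    ∃ S : Finset V, S.card ≤ channelSize δ ε B ∧ ∀ (f : ℕ → V) (n : ℕ),
      IsTrack K δ ε D x y g f n → ∀ t ≤ n, K.dist x (f t) ≤ Q + (2 * mu δ ε + ε) →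
        Q ≤ K.dist x (f t) + (2 * mu δ ε + ε) → f t ∈ S := by
  obtain ⟨M, hM⟩ : ∃ M, M = 2 * mu δ ε + 2 * ε + 1 := ⟨_, rfl⟩
  obtain ⟨S, hS, hS'⟩ := exists_finset_conesAlong_subset hB hg.geo.isVertexPath
    (I := (Finset.Icc (Q - M) (Q + M)).filter (· < K.dist x y))
    (fun i hi => (Finset.mem_filter.1 hi).2)
  refine ⟨S, hS'.trans (Nat.mul_le_mul_right _ ((Finset.card_filter_le _ _).trans ?_)), ?_⟩
  · rw [Nat.card_Icc]
    omega
  · intro f n hf t ht h1 h2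
    obtain ⟨i, hi, hfi⟩ := hcon x y g f n hxy hg hf.path hf.source hf.target hf.quasi t ht
    refine hS ⟨i, Finset.mem_filter.2 ⟨Finset.mem_Icc.2 ?_, hi⟩, hfi⟩
    have near : ∀ j ≤ K.dist x y, K.dist (g j) (f t) ≤ ε →
        j ≤ K.dist x (f t) + ε ∧ K.dist x (f t) ≤ j + ε := by
      intro j hj hd
      have h3 := hK.dist_triangle (u := x) (v := g j) (w := f t)
      have h4 := hK.dist_triangle (u := x) (v := f t) (w := g j)
      rw [SimpleGraph.dist_comm (u := f t)] at h4
      rw [hg.dist_source hj] at h3 h4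
      omega
    rcases hfi with h | h
    · have := near i (by omega) h.1
      omega
    · have := near (i + 1) (by omega) h.1
      omega

/-- A triangle has a bounded number of bad scales. Otherwise, among the bad paths of two scales
`l < l'`, two follow the same path of length `mu`, and the remaining times in their sections are
congruent modulo `cutLength`; one of the two splicings can then be redirected. -/
theorem card_isBadScale_le {δ ε D B G R T : ℕ} {x y z : V} {g h : ℕ → V}
    (hK : IsHyperbolicGraph δ K) (hδ : 0 < δ) (hε₀ : 0 < ε)
    (hD : IsMorseConstant K (1000 * δ) D) (hcon : IsConicalConstant K (1000 * δ) ε)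
    (hB : ∀ a b : V, K.Adj a b → ∃ F : Finset V, cone K ε ε a b ⊆ F ∧ F.card ≤ B)
    (hε : δ + 2 * (D + δ) ≤ 2 * ε) (hμ : cutLength δ D ≤ mu δ ε) (hG : R + 10 * T ≤ G)
    (hG₀ : 0 < G) (hfork : IsFork K δ G x y z g h) (𝓛 : Finset ℕ)
    (hbad : ∀ l ∈ 𝓛, IsBadScale K δ ε R x y z l) (hl : ∀ l ∈ 𝓛, mu δ ε ≤ l)
    (hT : ∀ l ∈ 𝓛, l + mu δ ε + ε + cutLength δ D + driftBound δ D + D < T)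
    (hsep : ∀ l ∈ 𝓛, ∀ l' ∈ 𝓛, l < l' → l + cutLength δ D ≤ l') :
    𝓛.card ≤ scaleCount δ ε D B := by
  have hc := hK.1
  have hxy : x ≠ y := by
    rintro rfl
    have := hfork.le_left
    rw [SimpleGraph.dist_self] at this
    omega
  obtain ⟨S, hS, hS'⟩ := exists_finset_of_isTrack (D := D) (Q := R + 2 * T) hc hcon hB hxy
    hfork.left
  obtain ⟨code, hcode⟩ := exists_code hS
  have hpass : ∀ l, ∃ (w : V) (f : ℕ → V) (n : ℕ) (c d : ℕ → ℕ) (k t j s : ℕ), l ∈ 𝓛 →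
      IsPassage K δ ε D l T (R + 2 * T) x y w g f n c d k t j s ∧
        w ∉ cylinder K δ ε l x z := by
    intro l
    by_cases hl' : l ∈ 𝓛
    · obtain ⟨w, f, n, c, d, k, t, j, s, hp⟩ := (hbad l hl').exists_isPassage hK hδ hε₀ hD hε hμ
        (hl l hl') (hT l hl') hG hfork
      exact ⟨w, f, n, c, d, k, t, j, s, fun _ => hp⟩
    · exact ⟨x, fun _ => x, 0, fun _ => 0, fun _ => 0, 0, 0, 0, 0, fun h => absurd h hl'⟩
  choose w f n c d k t j s hp using hpass
  have hC := cutLength_pos δ D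
  -- The colour of a scale: the path of length `mu` and the residue of the remaining time.
  by_contra! hcard
  obtain ⟨l, hl₁, l', hl₂, hne, heq⟩ := Finset.exists_ne_map_eq_of_card_lt_of_maps_to
    (s := 𝓛) (t := (Finset.univ :
      Finset ((Fin (mu δ ε + 1) → Fin (channelSize δ ε B + 1)) × Fin (cutLength δ D))))
    (f := fun l => (fun r : Fin (mu δ ε + 1) => code (f l (s l + r)),
      (⟨(d l (j l) - s l) % cutLength δ D, Nat.mod_lt _ hC⟩ : Fin (cutLength δ D))))
    (by simpa [scaleCount] using hcard) (fun _ _ => Finset.mem_coe.2 (Finset.mem_univ _))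
  wlog hlt : l < l' generalizing l l'
  · exact this l' hl₂ l hl₁ hne.symm heq.symm (by omega)
  obtain ⟨hp₁, hw₁⟩ := hp l hl₁
  obtain ⟨hp₂, hw₂⟩ := hp l' hl₂
  rw [Prod.mk.injEq] at heq
  have hmod : (d l (j l) - s l) % cutLength δ D = (d l' (j l') - s l') % cutLength δ D :=
    congrArg Fin.val heq.2
  have hmem : ∀ l ∈ 𝓛, ∀ r ≤ mu δ ε, f l (s l + r) ∈ S := by
    intro l hl r hr
    have hp := (hp l hl).1
    refine hS' (f l) (n l) hp.track _ ?_ (hp.le_add r hr) (hp.le_dist r hr)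
    have h1 := hp.le_d
    have h2 := hp.sectioned.d_le_d (i := j l) (j := j l + 1) (by omega) le_rfl
    have h3 := hp.d_le
    omega
  have hfol : ∀ r ≤ mu δ ε, f l (s l + r) = f l' (s l' + r) := fun r hr =>
    hcode (hmem l hl₁ r hr) (hmem l' hl₂ r hr) (congrFun heq.1 ⟨r, by omega⟩)
  rcases le_or_gt (d l (j l) - s l) (d l' (j l') - s l') with h1 | h1
  · exact hw₁ (hp₁.mem_cylinder_of_le hK hδ hε₀ hε hμ (hl l hl₁) (hsep l hl₁ l' hl₂ hlt)
      (hT l hl₁) (by omega) hfork hp₂ hfol h1)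
  · refine hw₂ (hp₂.mem_cylinder_of_longer hK hδ hε₀ hε hμ (hl l' hl₂) (hT l' hl₂) (by omega)
      hfork hp₁ (fun r hr => (hfol r hr).symm) ?_)
    -- Two distinct congruent integers differ by at least the modulus.
    have h2 : cutLength δ D ∣ (d l (j l) - s l) - (d l' (j l') - s l') :=
      (Nat.modEq_iff_dvd' h1.le).1 hmod.symm
    have h3 := Nat.le_of_dvd (by omega) h2
    omega

/-! ### Choice of the scale -/

theorem le_mu {δ ε : ℕ} (hδ : 0 < δ) : ε ≤ mu δ ε := by
  unfold mu lam
  calc ε ≤ (100 * ε + (1000 * δ) ^ 2) * 1 := by omega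
    _ ≤ _ := Nat.mul_le_mul_left _ (by omega)

/-- The capacity function: it bounds the number of channels, and is chosen large enough for
`phi` to exceed the number of scales that have to be considered. -/
noncomputable def capacity (δ ε D B L : ℕ) : ℕ :=
  nodupListCount (L * (2 * B)) + (mu δ ε + 1 + scaleCount δ ε D B * cutLength δ D)

theorem le_phi_capacity {δ ε D B n : ℕ} (hε : 0 < ε) :
    24 * (n + 1) * (mu δ ε + 1 + scaleCount δ ε D B * cutLength δ D) ≤
      phi δ ε (capacity δ ε D B) n := by
  unfold phi
  calc 24 * (n + 1) * (mu δ ε + 1 + scaleCount δ ε D B * cutLength δ D)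
      ≤ 24 * (n + 1) * capacity δ ε D B (mu δ ε) :=
        Nat.mul_le_mul_left _ (Nat.le_add_left _ _)
    _ ≤ 24 * (n + 1) * capacity δ ε D B (mu δ ε) * (2 * ε + 1) :=
        Nat.le_mul_of_pos_right _ (by omega)
    _ ≤ _ := Nat.le_mul_of_pos_right _ hε

/-- The scales among which a good one is to be found. -/
def candidateScales (δ ε D B n : ℕ) : Finset ℕ :=
  (Finset.range (6 * n * scaleCount δ ε D B + 1)).image
    fun a => mu δ ε + 1 + a * cutLength δ D

theorem card_candidateScales (δ ε D B n : ℕ) :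
    (candidateScales δ ε D B n).card = 6 * n * scaleCount δ ε D B + 1 := by
  unfold candidateScales
  rw [Finset.card_image_of_injective, Finset.card_range]
  intro a b hab
  exact Nat.eq_of_mul_eq_mul_right (cutLength_pos δ D) (by dsimp only at hab; omega)

/-- The inclusion of cylinders fails, at the scale `l`, for the triple `p`. -/
def FailsAt (K : SimpleGraph V) (δ ε : ℕ) (Capa : ℕ → ℕ) (n l : ℕ) (p : V × V × V) : Prop :=
  ∃ w ∈ cylinder K δ ε l p.1 p.2.1,
    (K.dist p.1 w : ℝ) ≤ agreementRadius K δ ε Capa n p.1 p.2.1 p.2.2 ∧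
      w ∉ cylinder K δ ε l p.1 p.2.2

theorem cylindersAgreeAt_of_not_failsAt {δ ε : ℕ} {Capa : ℕ → ℕ} {n l : ℕ} {x y z : V}
    (h : ¬ FailsAt K δ ε Capa n l (x, y, z)) (h' : ¬ FailsAt K δ ε Capa n l (x, z, y)) :
    CylindersAgreeAt K δ ε Capa n l x y z := by
  have hsymm : agreementRadius K δ ε Capa n x z y = agreementRadius K δ ε Capa n x y z := by
    unfold agreementRadius gromovProduct
    rw [SimpleGraph.dist_comm (u := z)]
    ring
  unfold FailsAt at h h'
  push Not at h h'
  dsimp only at h h'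
  rw [hsymm] at h'
  exact Set.Subset.antisymm (fun w hw => ⟨h w hw.1 hw.2, hw.2⟩) fun w hw => ⟨h' w hw.1 hw.2, hw.2⟩

theorem card_failsAt_le {δ ε D B n : ℕ} (hK : IsHyperbolicGraph δ K) (hδ : 0 < δ) (hε₀ : 0 < ε)
    (hD : IsMorseConstant K (1000 * δ) D) (hcon : IsConicalConstant K (1000 * δ) ε)
    (hB : ∀ a b : V, K.Adj a b → ∃ F : Finset V, cone K ε ε a b ⊆ F ∧ F.card ≤ B)
    (hε : δ + 2 * (D + δ) ≤ 2 * ε) (hμ : cutLength δ D ≤ mu δ ε) (p : V × V × V) (𝓛 : Finset ℕ)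
    (h𝓛 : 𝓛 ⊆ candidateScales δ ε D B n)
    (hfail : ∀ l ∈ 𝓛, FailsAt K δ ε (capacity δ ε D B) n l p) :
    𝓛.card ≤ scaleCount δ ε D B := by
  obtain ⟨x, y, z⟩ := p
  rcases 𝓛.eq_empty_or_nonempty with h0 | ⟨l₀, hl₀⟩
  · simp [h0]
  obtain ⟨C, hC⟩ : ∃ C, C = cutLength δ D := ⟨_, rfl⟩
  have hCpos : 0 < C := hC ▸ cutLength_pos δ D
  obtain ⟨A, hA⟩ : ∃ A, A = scaleCount δ ε D B * C := ⟨_, rfl⟩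
  obtain ⟨ρ, hρ⟩ : ∃ ρ, ρ = agreementRadius K δ ε (capacity δ ε D B) n x y z := ⟨_, rfl⟩
  obtain ⟨W, hW⟩ : ∃ W, W = 4 * (11 * mu δ ε + phi δ ε (capacity δ ε D B) n) := ⟨_, rfl⟩
  have hρ₀ : 0 ≤ ρ := by
    obtain ⟨w, -, hw, -⟩ := hfail l₀ hl₀
    rw [hρ]
    exact (Nat.cast_nonneg _).trans hw
  have hfloor := Nat.floor_le hρ₀
  -- The margin `W` leaves room, beyond the ball, for several sections at each candidate scale.
  have hG : ((⌊ρ⌋₊ + W : ℕ) : ℝ) ≤ gromovProduct K x y z := by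
    have h1 : ρ = gromovProduct K x y z - W := by
      rw [hρ, hW]
      unfold agreementRadius
      push_cast
      ring
    push_cast
    linarith
  obtain ⟨g, hg⟩ := exists_isGeodesicFromTo hK.1 x y
  obtain ⟨h, hh⟩ := exists_isGeodesicFromTo hK.1 x z
  have hfork := isFork_of_le_gromovProduct hK hg hh hG
  have hphi := le_phi_capacity (δ := δ) (D := D) (B := B) (n := n) hε₀
  rw [← hC, ← hA] at hphi
  have e1 : 24 * (n + 1) * (mu δ ε + 1 + A) = 24 * (mu δ ε + 1 + A) + 24 * (n * (mu δ ε + 1)) +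
      24 * (n * A) := by ring
  have hDC : driftBound δ D + D ≤ C := by
    rw [hC]
    exact (show driftBound δ D + D ≤ cutStep δ D by unfold cutStep; omega).trans
      (Nat.le_mul_of_pos_left _ (by omega))
  have hεμ : ε ≤ mu δ ε := le_mu hδ
  have hcand : ∀ l ∈ 𝓛, ∃ a, a ≤ 6 * n * scaleCount δ ε D B ∧ l = mu δ ε + 1 + a * C := by
    intro l hl
    obtain ⟨a, ha, rfl⟩ := Finset.mem_image.1 (h𝓛 hl)
    exact ⟨a, Nat.lt_succ_iff.1 (Finset.mem_range.1 ha), by rw [hC]⟩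
  rw [← hC] at hμ
  refine card_isBadScale_le (R := ⌊ρ⌋₊) (T := 5 * mu δ ε + 2 + 6 * (n * A)) hK hδ hε₀ hD hcon hB hε
    (hC ▸ hμ) (by omega) (by omega) hfork 𝓛 ?_ ?_ ?_ ?_
  · intro l hl
    obtain ⟨w, hw, hwρ, hwz⟩ := hfail l hl
    exact ⟨w, hw, Nat.le_floor (hρ ▸ hwρ), hwz⟩
  · intro l hl
    obtain ⟨a, -, rfl⟩ := hcand l hl
    omega
  · intro l hl
    obtain ⟨a, ha, rfl⟩ := hcand l hl
    have h1 := Nat.mul_le_mul_right C ha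
    have h2 : 6 * n * scaleCount δ ε D B * C = 6 * (n * A) := by rw [hA]; ring
    rw [← hC]
    omega
  · intro l hl l' hl' hll'
    obtain ⟨a, -, rfl⟩ := hcand l hl
    obtain ⟨b, -, rfl⟩ := hcand l' hl'
    rw [← hC]
    have hab : a < b := by
      by_contra! hle
      have := Nat.mul_le_mul_right C hle
      omega
    have := Nat.mul_le_mul_right C (show a + 1 ≤ b from hab)
    rw [Nat.succ_mul] at this
    omega

/-- If a finite set of triples is not too large, then some scale is good for all of them. -/
theorem exists_scale {δ ε D B n : ℕ} (hK : IsHyperbolicGraph δ K) (hδ : 0 < δ) (hε₀ : 0 < ε)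
    (hD : IsMorseConstant K (1000 * δ) D) (hcon : IsConicalConstant K (1000 * δ) ε)
    (hB : ∀ a b : V, K.Adj a b → ∃ F : Finset V, cone K ε ε a b ⊆ F ∧ F.card ≤ B)
    (hε : δ + 2 * (D + δ) ≤ 2 * ε) (hμ : cutLength δ D ≤ mu δ ε) (𝒯 : Finset (V × V × V))
    (h𝒯 : 𝒯.card ≤ 6 * n) :
    ∃ l, mu δ ε < l ∧ ∀ p ∈ 𝒯, ¬ FailsAt K δ ε (capacity δ ε D B) n l p := by
  classical
  by_contra! hcon'
  have hfail : ∀ l, ∃ p, l ∈ candidateScales δ ε D B n →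
      p ∈ 𝒯 ∧ FailsAt K δ ε (capacity δ ε D B) n l p := by
    intro l
    by_cases hl : l ∈ candidateScales δ ε D B n
    · obtain ⟨a, -, rfl⟩ := Finset.mem_image.1 hl
      obtain ⟨p, hp⟩ := hcon' (mu δ ε + 1 + a * cutLength δ D) (by omega)
      exact ⟨p, fun _ => hp⟩
    · by_cases h : Nonempty V
      · exact ⟨(h.some, h.some, h.some), fun h => absurd h hl⟩
      · exact absurd hK.1.nonempty h
  choose p hp using hfail
  obtain ⟨q, -, hq⟩ := Finset.exists_lt_card_fiber_of_mul_lt_card_of_maps_to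
    (s := candidateScales δ ε D B n) (t := 𝒯) (f := p) (n := scaleCount δ ε D B)
    (fun l hl => (hp l hl).1) (by
      rw [card_candidateScales]
      exact Nat.lt_succ_of_le (Nat.mul_le_mul_right _ h𝒯))
  refine absurd hq (not_lt_of_ge (card_failsAt_le hK hδ hε₀ hD hcon hB hε hμ q _
    (Finset.filter_subset _ _) fun l hl => ?_))
  obtain ⟨hl₁, hl₂⟩ := Finset.mem_filter.1 hl
  exact hl₂ ▸ (hp l hl₁).2

/-- The ordered triples of vertices of the triangles `(p, α p, γ⁻¹ p)`. -/
theorem exists_finset_triples {Γ : Type v} [Group Γ] [MulAction Γ V] (F : Finset Γ) (p : V) :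
    ∃ 𝒯 : Finset (V × V × V), 𝒯.card ≤ 6 * (2 * F.card) ^ 3 ∧
      ∀ α γ : Γ, (α ∈ F ∨ α⁻¹ ∈ F) → (γ ∈ F ∨ γ⁻¹ ∈ F) →
        (p, α • p, γ⁻¹ • p) ∈ 𝒯 ∧ (p, γ⁻¹ • p, α • p) ∈ 𝒯 ∧ (α • p, γ⁻¹ • p, p) ∈ 𝒯 ∧
          (α • p, p, γ⁻¹ • p) ∈ 𝒯 ∧ (γ⁻¹ • p, p, α • p) ∈ 𝒯 ∧ (γ⁻¹ • p, α • p, p) ∈ 𝒯 := by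
  classical
  obtain ⟨S, hS⟩ : ∃ S, S = F ∪ F.image (·⁻¹) := ⟨_, rfl⟩
  have hmem : ∀ α : Γ, (α ∈ F ∨ α⁻¹ ∈ F) → α ∈ S := by
    intro α hα
    rw [hS, Finset.mem_union, Finset.mem_image]
    exact hα.imp_right fun h => ⟨α⁻¹, h, inv_inv α⟩
  have hcard : S.card ≤ 2 * F.card := by
    rw [hS]
    exact (Finset.card_union_le _ _).trans (by
      have := Finset.card_image_le (s := F) (f := fun a : Γ => a⁻¹)
      omega)
  refine ⟨(S ×ˢ S).biUnion fun a => {(p, a.1 • p, a.2⁻¹ • p), (p, a.2⁻¹ • p, a.1 • p),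
    (a.1 • p, a.2⁻¹ • p, p), (a.1 • p, p, a.2⁻¹ • p), (a.2⁻¹ • p, p, a.1 • p),
    (a.2⁻¹ • p, a.1 • p, p)}, ?_, fun α γ hα hγ => ?_⟩
  · refine (Finset.card_biUnion_le_card_mul _ _ 6 fun a _ => Finset.card_le_six).trans ?_
    rw [Finset.card_product, mul_comm]
    refine Nat.mul_le_mul_left _ ((Nat.mul_le_mul hcard hcard).trans ?_)
    rcases Nat.eq_zero_or_pos (2 * F.card) with h | h
    · simp [h]
    · calc 2 * F.card * (2 * F.card) ≤ 2 * F.card * (2 * F.card) * (2 * F.card) :=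
          Nat.le_mul_of_pos_right _ h
        _ = (2 * F.card) ^ 3 := by ring
  · have h : (α, γ) ∈ S ×ˢ S := Finset.mem_product.2 ⟨hmem α hα, hmem γ hγ⟩
    refine ⟨?_, ?_, ?_, ?_, ?_, ?_⟩ <;> refine Finset.mem_biUnion.2 ⟨(α, γ), h, ?_⟩ <;> simp

end CanonicalCylinders

open CanonicalCylinders in
theorem mainTheorem2 (δ : ℕ) (hδ : 1 < δ) :
    ∃ N : ℕ, ∀ ε : ℕ, N ≤ ε →
      IsConicalStabilityConstant.{u} (lam δ : ℝ) δ ε ∧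
      ∀ (Γ : Type v) [Group Γ] (𝒢 : Set (Subgroup Γ)) (V : Type u) [MulAction Γ V]
        (K : SimpleGraph V), IsAssociatedGraph Γ 𝒢 K → IsHyperbolicGraph δ K →
        ∃ Capa : ℕ → ℕ, IsCapacityBound K ε Capa ∧
          ∀ (F : Finset Γ) (n : ℕ), n = (2 * F.card) ^ 3 → ∀ p : V,
            ∃ l : ℕ, mu δ ε < l ∧
              ∀ α β γ : Γ, (α ∈ F ∨ α⁻¹ ∈ F) → (β ∈ F ∨ β⁻¹ ∈ F) → (γ ∈ F ∨ γ⁻¹ ∈ F) →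
                α * β * γ = 1 →
                ∀ x y z : V, x = p → y = α • p → z = γ⁻¹ • p →
                  CylindersAgreeAt K δ ε Capa n l x y z ∧
                  CylindersAgreeAt K δ ε Capa n l y z x ∧
                  CylindersAgreeAt K δ ε Capa n l z x y := by
  obtain ⟨N₁, hN₁⟩ := exists_isConicalStabilityConstant.{u} δ (1000 * δ) (by omega)
  obtain ⟨N₂, hN₂⟩ := exists_conical_constant.{u} δ (1000 * δ) (by omega)
  obtain ⟨D, hD⟩ := exists_morse_constant.{u} δ (1000 * δ)
  refine ⟨N₁ + N₂ + (δ + 2 * (D + δ)) + cutLength δ D + 1, fun ε hε => ⟨hN₁ ε (by omega), ?_⟩⟩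
  intro Γ _ 𝒢 V _ K hass hK
  obtain ⟨B, hB⟩ := exists_cone_bound hass ε ε
  refine ⟨capacity δ ε D B, isCapacityBound_of_cone_bound hB fun L => Nat.le_add_right _ _, ?_⟩
  rintro F n rfl p
  -- The equality of two cylinders in a ball amounts to two inclusions, one for each order of the
  -- ends of the sides; this makes six ordered triples for each triangle.
  obtain ⟨𝒯, h𝒯, hmem⟩ := exists_finset_triples F p
  have hμ : ε ≤ mu δ ε := le_mu (by omega)
  obtain ⟨l, hl, hgood⟩ := exists_scale hK (by omega) (by omega) (hD V K hK)
    (hN₂ ε (by omega) V K hK) hB (by omega) (by omega) 𝒯 h𝒯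
  refine ⟨l, hl, ?_⟩
  rintro α β γ hα - hγ - x y z rfl rfl rfl
  obtain ⟨h1, h2, h3, h4, h5, h6⟩ := hmem α γ hα hγ
  exact ⟨cylindersAgreeAt_of_not_failsAt (hgood _ h1) (hgood _ h2),
    cylindersAgreeAt_of_not_failsAt (hgood _ h3) (hgood _ h4),
    cylindersAgreeAt_of_not_failsAt (hgood _ h5) (hgood _ h6)⟩
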